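/- Manifolds are smooth, finite-dimensional and without boundary, and vector bundles are smooth, real and of finite rank. A VB-groupoid $(\Omega;B,\mathcal G;P)$ consists of Lie groupoids $\Omega\rightrightarrows B$ and $\mathcal G\rightrightarrows P$ (source $\tilde\alpha$ resp. $\alpha$, target $\tilde\beta$ resp. $\beta$) and vector bundles $\tilde\lambda\colon\Omega\to\mathcal G$ and $\lambda\colon B\to P$, such that source, target, identity inclusion and multiplication of $\Omega$ are morphisms of vector bundles over the corresponding maps of $\mathcal G$, and such that $(\tilde\alpha,\tilde\lambda)\colon\Omega\to B\times_P\mathcal G=\{(b,\gamma):\lambda(b)=\alpha(\gamma)\}$ is a surjective submersion. Its core is the vector bundle $K\to P$ with fibres $K_p=\{k\in\Omega_{1_p}:\tilde\alpha(k)=0\}$. A morphism over $\mathcal G\rightrightarrows P$ is a pair $F\colon\Omega\to\Omega'$, $f_B\colon B\to B'$ of vector bundle morphisms over $\mathrm{id}_{\mathcal G}$ and $\mathrm{id}_P$ which is a morphism of Lie groupoids; it restricts to a vector bundle morphism $f_K\colon K\to K'$ of the cores. The dual of $(\Omega;B,\mathcal G;P)$ is the dual bundle $\Omega^*\to\mathcal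 G$ with the groupoid structure over $K^*$ given by $$\langle\tilde\beta_*(\Phi),k\rangle=\langle\Phi,k\,\tilde 0_\gamma\rangle\ (k\in K_{\beta(\gamma)}),\qquad \langle\tilde\alpha_*(\Phi),k\rangle=\langle\Phi,-\tilde 0_\gamma k^{-1}\rangle\ (k\in K_{\alpha(\gamma)})$$ for $\Phi\in\Omega^*_\gamma$, by $\langle\Psi\Phi,\eta\xi\rangle=\langle\Psi,\eta\rangle+\langle\Phi,\xi\rangle$ for composable $\Psi\in\Omega^*_\delta$, $\Phi\in\Omega^*_\gamma$ and composable $\eta\in\Omega_\delta$, $\xi\in\Omega_\gamma$, and by $\langle\tilde 1_\chi,\tilde 1_b+k\rangle=\langle\chi,k\rangle$ for $\chi\in K^*_p$, $b\in B_p$, $k\in K_p$. A short exact sequence of VB-groupoids over $\mathcal G\rightrightarrows P$ consists of two morphisms $(F,f_B)$ from $(\Omega_1;B_1,\mathcal G;P)$ to $(\Omega_2;B_2,\mathcal G;P)$ and $(H,h_B)$ from $(\Omega_2;B_2,\mathcal G;P)$ to $(\Omega_3;B_3,\mathcal G;P)$ over $\mathcal G\rightrightarrows P$ such that $\Omega_1\xrightarrow{F}\Omega_2\xrightarrow{H}\Omega_3$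 is a short exact sequence of vector bundles over $\mathcal G$ ($F$ fibrewise injective, $H$ fibrewise surjective, $\operatorname{im}F=\ker H$). **Theorem.** For every short exact sequence of VB-groupoids over $\mathcal G\rightrightarrows P$ as above, with cores $K_1,K_2,K_3$: (i) $B_1\xrightarrow{f_B}B_2\xrightarrow{h_B}B_3$ is a short exact sequence of vector bundles over $P$; (ii) $K_1\xrightarrow{f_K}K_2\xrightarrow{h_K}K_3$ is a short exact sequence of vector bundles over $P$; (iii) the formulas above make $(\Omega_i^*;K_i^*,\mathcal G;P)$, $i=1,2,3$, into VB-groupoids, and the dual maps $(H^*,h_K^*)$ from $(\Omega_3^*;K_3^*,\mathcal G;P)$ to $(\Omega_2^*;K_2^*,\mathcal G;P)$ and $(F^*,f_K^*)$ from $(\Omega_2^*;K_2^*,\mathcal G;P)$ to $(\Omega_1^*;K_1^*,\mathcal G;P)$ form a short exact sequence of VB-groupoids over $\mathcal G\rightrightarrows P$. -/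

import Mathlib

open Bundle Manifold ContDiff Topology


universe uE uH uM uF uV

set_option linter.checkUnivs false in
/-- A smooth real vector bundle of finite rank over `M`: fibres `fib x`, model fibre `F`, and
Mathlib's smooth vector bundle structure on them. -/
structure SmoothVB {E : Type uE} {H : Type uH} [NormedAddCommGroup E] [NormedSpace ℝ E]
    [TopologicalSpace H] (I : ModelWithCorners ℝ E H) (M : Type uM) [TopologicalSpace M]
    [ChartedSpace H M] where
  F : Type uF
  fib : M → Type uV
  [normedF : NormedAddCommGroup F]
  [spaceF : NormedSpace ℝ F]
  [finF : FiniteDimensional ℝ F]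
  [addFib : ∀ x, AddCommGroup (fib x)]
  [modFib : ∀ x, Module ℝ (fib x)]
  [topFib : ∀ x, TopologicalSpace (fib x)]
  [topTot : TopologicalSpace (TotalSpace F fib)]
  [fiberBundle : FiberBundle F fib]
  [vectorBundle : VectorBundle ℝ F fib]
  [smoothBundle : ContMDiffVectorBundle ∞ F fib I]

attribute [instance] SmoothVB.normedF SmoothVB.spaceF SmoothVB.finF SmoothVB.addFib SmoothVB.modFib
  SmoothVB.topFib SmoothVB.topTot SmoothVB.fiberBundle SmoothVB.vectorBundle SmoothVB.smoothBundle

noncomputable section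

namespace SmoothVB

variable {E H : Type*} [NormedAddCommGroup E] [NormedSpace ℝ E] [TopologicalSpace H]
  {I : ModelWithCorners ℝ E H} {M : Type*} [TopologicalSpace M] [ChartedSpace H M]

/-- The total space, a manifold. -/
abbrev Tot (V : SmoothVB I M) := TotalSpace V.F V.fib

/-- The model of the total space as a manifold. -/
abbrev model (V : SmoothVB I M) := I.prod 𝓘(ℝ, V.F)

/-- The dual vector bundle, with fibres the dual spaces of the fibres. -/
def dual (V : SmoothVB I M) : SmoothVB I M where
  F := V.F →L[ℝ] ℝ
  fib x := V.fib x →L[ℝ] Bundle.Trivial M ℝ x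

/-- The pairing of a covector with a vector. -/
def pair (V : SmoothVB I M) {x : M} (Φ : V.dual.fib x) (v : V.fib x) : ℝ :=
  (show V.fib x →L[ℝ] ℝ from Φ) v

/-- A family of linear maps of the fibres of two vector bundles over `M`. -/
abbrev FibHom (V W : SmoothVB I M) := ∀ x, V.fib x →L[ℝ] W.fib x

variable {U V W : SmoothVB I M}

/-- The map of total spaces of a family of linear maps. -/
def FibHom.total (f : FibHom V W) : V.Tot → W.Tot := fun v => ⟨v.1, f v.1 v.2⟩

/-- The family is a morphism of smooth vector bundles over the identity of `M`. -/
def FibHom.IsMorphism (f : FibHom V W) : Prop := ContMDiff V.model W.model ∞ f.total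

/-- The dual family, `Φ ↦ Φ ∘ f x`. -/
def FibHom.dual (f : FibHom V W) : FibHom W.dual V.dual :=
  fun x => ContinuousLinearMap.precomp ℝ (f x)

/-- `0 → U → V → W → 0` is a short exact sequence of smooth vector bundles over `M`. -/
structure IsShortExact (f : FibHom U V) (g : FibHom V W) : Prop where
  morphism_left : f.IsMorphism
  morphism_right : g.IsMorphism
  injective : ∀ x, Function.Injective (f x)
  exact : ∀ x, Function.Exact (f x) (g x)
  surjective : ∀ x, Function.Surjective (g x)

end SmoothVB

namespace KernelBundle

variable {E H : Type*} [NormedAddCommGroup E] [NormedSpace ℝ E] [TopologicalSpace H]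
  {I : ModelWithCorners ℝ E H} {M : Type*} [TopologicalSpace M] [ChartedSpace H M]
  {E₁ H₁ : Type*} [NormedAddCommGroup E₁] [NormedSpace ℝ E₁] [TopologicalSpace H₁]
  {I₁ : ModelWithCorners ℝ E₁ H₁} {N₁ : Type*} [TopologicalSpace N₁] [ChartedSpace H₁ N₁]
  {E₂ H₂ : Type*} [NormedAddCommGroup E₂] [NormedSpace ℝ E₂] [TopologicalSpace H₂]
  {I₂ : ModelWithCorners ℝ E₂ H₂} {N₂ : Type*} [TopologicalSpace N₂] [ChartedSpace H₂ N₂]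

/-- A smooth family `A x : Om_{g x} → B_{f x}` (`x ∈ M`) of surjective linear maps between fibres of
two smooth vector bundles, along smooth maps `g` and `f`. Smoothness is that of the matrix of `A`
in the local trivializations of the two bundles. -/
structure SurjFamily (I : ModelWithCorners ℝ E H) (M : Type*) [TopologicalSpace M]
    [ChartedSpace H M] (Om : SmoothVB I₁ N₁) (B : SmoothVB I₂ N₂) where
  g : M → N₁
  f : M → N₂
  A : ∀ x, Om.fib (g x) →L[ℝ] B.fib (f x)
  smooth_g : ContMDiff I I₁ ∞ g
  smooth_f : ContMDiff I I₂ ∞ f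
  surj : ∀ x, Function.Surjective (A x)
  smooth_A : ∀ x₀ : M, ContMDiffOn I 𝓘(ℝ, Om.F →L[ℝ] B.F) ∞
    (fun x => ContinuousLinearMap.inCoordinates Om.F Om.fib B.F B.fib (g x₀) (g x) (f x₀) (f x) (A x))
    (g ⁻¹' (trivializationAt Om.F Om.fib (g x₀)).baseSet ∩
      f ⁻¹' (trivializationAt B.F B.fib (f x₀)).baseSet)

variable {Om : SmoothVB I₁ N₁} {B : SmoothVB I₂ N₂} (K : SurjFamily I M Om B)

namespace SurjFamily

/-- The fibre at `x` of the kernel bundle: the kernel of `A x`, a subspace of `Om_{g x}`. -/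
abbrev fib (x : M) : Submodule ℝ (Om.fib (K.g x)) :=
  LinearMap.ker (K.A x : Om.fib (K.g x) →ₗ[ℝ] B.fib (K.f x))

/-- The fibres of the kernel bundle as a family of types. -/
abbrev Fib (x : M) : Type _ := K.fib x

/-- The model fibre of the kernel bundle; its rank is the difference of the ranks. -/
abbrev model (_K : SurjFamily I M Om B) : Type :=
  EuclideanSpace ℝ (Fin (Module.finrank ℝ Om.F - Module.finrank ℝ B.F))

/-- The points over which the trivializations of both bundles around `x₀` are defined. -/
def base (x₀ : M) : Set M := K.g ⁻¹' (trivializationAt Om.F Om.fib (K.g x₀)).baseSet ∩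
      K.f ⁻¹' (trivializationAt B.F B.fib (K.f x₀)).baseSet

variable {K} in
/-- The given trivialization of the ambient bundle around `x₀`, at `x`. -/
def φ {x₀ x : M} (hx : x ∈ K.base x₀) : Om.fib (K.g x) ≃L[ℝ] Om.F :=
  (trivializationAt Om.F Om.fib (K.g x₀)).continuousLinearEquivAt ℝ (K.g x) hx.1

variable {K} in
/-- The given trivialization of the target bundle around `x₀`, at `x`. -/
def ψ {x₀ x : M} (hx : x ∈ K.base x₀) : B.fib (K.f x) ≃L[ℝ] B.F :=
  (trivializationAt B.F B.fib (K.f x₀)).continuousLinearEquivAt ℝ (K.f x) hx.2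

variable {K} in
lemma φ_apply {x₀ x : M} (hx : x ∈ K.base x₀) (v : Om.fib (K.g x)) :
    φ hx v = (trivializationAt Om.F Om.fib (K.g x₀) ⟨K.g x, v⟩).2 := rfl

/-- The family read in the trivializations around `x₀`. -/
def coordA (x₀ x : M) : Om.F →L[ℝ] B.F :=
  ContinuousLinearMap.inCoordinates Om.F Om.fib B.F B.fib (K.g x₀) (K.g x) (K.f x₀) (K.f x) (K.A x)

lemma mem_base (x₀ : M) : x₀ ∈ K.base x₀ :=
  ⟨FiberBundle.mem_baseSet_trivializationAt' (K.g x₀),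
    FiberBundle.mem_baseSet_trivializationAt' (K.f x₀)⟩

lemma isOpen_base (x₀ : M) : IsOpen (K.base x₀) :=
  ((trivializationAt Om.F Om.fib (K.g x₀)).open_baseSet.preimage K.smooth_g.continuous).inter
    ((trivializationAt B.F B.fib (K.f x₀)).open_baseSet.preimage K.smooth_f.continuous)

lemma coordA_apply {x₀ x : M} (hx : x ∈ K.base x₀) (v : Om.fib (K.g x)) :
    K.coordA x₀ x (φ hx v) = ψ hx (K.A x v) := by
  have h : K.coordA x₀ x = ((ψ hx : B.fib (K.f x) →L[ℝ] B.F) ∘L K.A x ∘L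
      ((φ hx).symm : Om.F →L[ℝ] Om.fib (K.g x))) :=
    ContinuousLinearMap.inCoordinates_eq hx.1 hx.2
  rw [h]
  change ψ hx (K.A x ((φ hx).symm (φ hx v))) = _
  rw [ContinuousLinearEquiv.symm_apply_apply]

lemma exists_complement (a : Om.F →L[ℝ] B.F) (ha : Function.Surjective a) :
    ∃ Q : Om.F →L[ℝ] K.model, (a.prod Q).IsInvertible := by
  obtain ⟨l, rfl⟩ : ∃ l : Om.F →ₗ[ℝ] B.F, a = LinearMap.toContinuousLinearMap l := ⟨a, rfl⟩
  have h1 := l.finrank_range_add_finrank_ker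
  have hr : LinearMap.range l = ⊤ := LinearMap.range_eq_top.2 ha
  rw [hr, finrank_top] at h1
  have h2 : Module.finrank ℝ (LinearMap.ker l) = Module.finrank ℝ K.model := by
    rw [finrank_euclideanSpace_fin]; omega
  obtain ⟨e⟩ := FiniteDimensional.nonempty_linearEquiv_of_finrank_eq h2
  obtain ⟨p, hp⟩ := (LinearMap.ker l).exists_isCompl
  let Q : Om.F →ₗ[ℝ] K.model := e.toLinearMap ∘ₗ Submodule.projectionOnto _ p hp
  refine ⟨LinearMap.toContinuousLinearMap Q, ?_⟩
  have hinj : Function.Injective (l.prod Q) := by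
    rw [injective_iff_map_eq_zero]
    intro v hv
    have h3 : v ∈ LinearMap.ker l := congrArg Prod.fst hv
    have h4 : e (Submodule.projectionOnto _ p hp v) = 0 := congrArg Prod.snd hv
    have h6 := Submodule.projectionOnto_apply_left hp ⟨v, h3⟩
    rw [LinearEquiv.map_eq_zero_iff] at h4
    exact (congrArg Subtype.val (h6.symm.trans h4))
  have hd : Module.finrank ℝ Om.F = Module.finrank ℝ (B.F × K.model) := by
    rw [Module.finrank_prod, ← h2, h1]
  let L := LinearEquiv.ofInjectiveOfFinrankEq _ hinj hd
  exact ⟨L.toContinuousLinearEquiv, by ext v <;> rfl⟩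

lemma coordA_surj (x₀ : M) : Function.Surjective (K.coordA x₀ x₀) := by
  intro w
  obtain ⟨v, hv⟩ := K.surj x₀ ((ψ (K.mem_base x₀)).symm w)
  refine ⟨_, (K.coordA_apply (K.mem_base x₀) v).trans ?_⟩
  rw [hv, ContinuousLinearEquiv.apply_symm_apply]

/-- A linear map complementary to the family at `x₀`. -/
def compl (x₀ : M) : Om.F →L[ℝ] K.model := (K.exists_complement _ (K.coordA_surj x₀)).choose

/-- The family in coordinates, completed by the complementary map. -/
def T (x₀ x : M) : Om.F →L[ℝ] B.F × K.model := (K.coordA x₀ x).prod (K.compl x₀)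

lemma T_invertible (x₀ : M) : (K.T x₀ x₀).IsInvertible :=
  (K.exists_complement _ (K.coordA_surj x₀)).choose_spec

lemma smooth_T (x₀ : M) : ContMDiffOn I 𝓘(ℝ, Om.F →L[ℝ] B.F × K.model) ∞ (K.T x₀) (K.base x₀) := by
  have h : K.T x₀ = fun x => (ContinuousLinearMap.inl ℝ B.F K.model) ∘L (K.coordA x₀ x) +
      (ContinuousLinearMap.inr ℝ B.F K.model) ∘L (K.compl x₀) := by
    funext x; ext v <;> simp [T]
  rw [h]
  exact (contMDiffOn_const.clm_comp (K.smooth_A x₀)).add contMDiffOn_const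

/-- The domain of the trivialization of the kernel bundle around `x₀`. -/
def nhd (x₀ : M) : Set M := K.base x₀ ∩ {x | (K.T x₀ x).IsInvertible}

lemma isOpen_nhd (x₀ : M) : IsOpen (K.nhd x₀) :=
  (K.smooth_T x₀).continuousOn.isOpen_inter_preimage (K.isOpen_base x₀) ContinuousLinearEquiv.isOpen

lemma nhd_base {x₀ x : M} (hx : x ∈ K.nhd x₀) : x ∈ K.base x₀ := hx.1

lemma T_inv {x₀ x : M} (hx : x ∈ K.nhd x₀) (y : B.F × K.model) :
    K.T x₀ x ((K.T x₀ x).inverse y) = y := by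
  obtain ⟨e, he⟩ := hx.2
  rw [← he]; simp

lemma inv_T {x₀ x : M} (hx : x ∈ K.nhd x₀) (y : Om.F) :
    (K.T x₀ x).inverse (K.T x₀ x y) = y := by
  obtain ⟨e, he⟩ := hx.2
  rw [← he]; simp

lemma smooth_T_inv (x₀ : M) : ContMDiffOn I 𝓘(ℝ, B.F × K.model →L[ℝ] Om.F) ∞
    (fun x => (K.T x₀ x).inverse) (K.nhd x₀) := by
  intro x hx
  have h1 : ContMDiffAt 𝓘(ℝ, Om.F →L[ℝ] B.F × K.model) 𝓘(ℝ, B.F × K.model →L[ℝ] Om.F) ∞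
      ContinuousLinearMap.inverse (K.T x₀ x) :=
    (ContinuousLinearMap.IsInvertible.contDiffAt_map_inverse hx.2).contMDiffAt
  exact h1.comp_contMDiffWithinAt x (((K.smooth_T x₀).mono Set.inter_subset_left) x hx)

lemma symm_mem {x₀ x : M} (hx : x ∈ K.nhd x₀) (w : K.model) :
    (φ (K.nhd_base hx)).symm ((K.T x₀ x).inverse (0, w)) ∈ K.fib x := by
  have h := K.coordA_apply (K.nhd_base hx)
    ((φ (K.nhd_base hx)).symm ((K.T x₀ x).inverse (0, w)))
  rw [ContinuousLinearEquiv.apply_symm_apply] at h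
  have h3 : K.coordA x₀ x ((K.T x₀ x).inverse (0, w)) = 0 := congrArg Prod.fst (K.T_inv hx (0, w))
  rw [h3] at h
  exact (ContinuousLinearEquiv.map_eq_zero_iff _).1 h.symm

lemma T_of_mem {x₀ x : M} (hx : x ∈ K.base x₀) (v : K.fib x) :
    K.T x₀ x (φ hx v.1) = (0, K.compl x₀ (φ hx v.1)) := by
  refine Prod.ext ?_ rfl
  have h : K.A x v.1 = 0 := v.2
  have h' := K.coordA_apply hx v.1
  rw [h, map_zero] at h'
  exact h'

/-- The vector of the kernel at `x` with coordinate `w`. -/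
def vec {x₀ x : M} (hx : x ∈ K.nhd x₀) (w : K.model) : K.Fib x :=
  ⟨(φ (K.nhd_base hx)).symm ((K.T x₀ x).inverse (0, w)), K.symm_mem hx w⟩

lemma φ_vec {x₀ x : M} (hx : x ∈ K.nhd x₀) (w : K.model) :
    φ (K.nhd_base hx) (K.vec hx w).1 = (K.T x₀ x).inverse (0, w) :=
  ContinuousLinearEquiv.apply_symm_apply _ _

open Classical in
/-- The trivialization of the kernel bundle around `x₀`. -/
def localTriv (x₀ : M) : Pretrivialization K.model (π K.model K.Fib) where
  toFun v := (v.1, K.compl x₀ (trivializationAt Om.F Om.fib (K.g x₀) ⟨K.g v.1, v.2.1⟩).2)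
  invFun p := ⟨p.1, if hx : p.1 ∈ K.nhd x₀ then K.vec hx p.2 else 0⟩
  source := π K.model K.Fib ⁻¹' K.nhd x₀
  target := K.nhd x₀ ×ˢ Set.univ
  baseSet := K.nhd x₀
  map_source' v hv := ⟨hv, trivial⟩
  map_target' p hp := hp.1
  left_inv' := by
    rintro ⟨x, v⟩ hx
    have hx : x ∈ K.nhd x₀ := hx
    simp only [hx, dite_true]
    congr 1
    apply Subtype.ext
    apply (φ (K.nhd_base hx)).injective
    rw [φ_vec, ← φ_apply (K.nhd_base hx), ← T_of_mem, inv_T _ hx]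
  right_inv' := by
    rintro ⟨x, w⟩ ⟨hx, -⟩
    have hx : x ∈ K.nhd x₀ := hx
    simp only [hx, dite_true]
    congr 1
    rw [← φ_apply (K.nhd_base hx), φ_vec]
    exact congrArg Prod.snd (K.T_inv hx (0, w))
  open_target := (K.isOpen_nhd x₀).prod isOpen_univ
  open_baseSet := K.isOpen_nhd x₀
  source_eq := rfl
  target_eq := rfl
  proj_toFun _ _ := rfl

lemma localTriv_apply {x₀ x : M} (hx : x ∈ K.nhd x₀) (v : K.Fib x) :
    (K.localTriv x₀ ⟨x, v⟩).2 = K.compl x₀ (φ (K.nhd_base hx) v.1) := rfl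

open Classical in
lemma localTriv_symm {x₀ x : M} (hx : x ∈ K.nhd x₀) (w : K.model) :
    (K.localTriv x₀).symm x w = K.vec hx w := by
  have h1 : x ∈ (K.localTriv x₀).baseSet := hx
  have h2 : ((K.localTriv x₀).toPartialEquiv.symm (x, w)) = ⟨x, K.vec hx w⟩ := by
    change (⟨x, if hx : x ∈ K.nhd x₀ then K.vec hx w else 0⟩ : TotalSpace K.model K.Fib) = _
    simp [hx]
  have h3 := (K.localTriv x₀).mk_symm h1 w
  have h4 := h3.trans h2
  exact eq_of_heq (TotalSpace.mk.inj h4).2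

/-- The coordinate changes. -/
def coordChange (x₀ x₁ x : M) : K.model →L[ℝ] K.model :=
  K.compl x₁ ∘L ((trivializationAt Om.F Om.fib (K.g x₀)).coordChangeL ℝ
    (trivializationAt Om.F Om.fib (K.g x₁)) (K.g x) : Om.F →L[ℝ] Om.F) ∘L
      (K.T x₀ x).inverse ∘L ContinuousLinearMap.inr ℝ B.F K.model

lemma smooth_coordChange (x₀ x₁ : M) : ContMDiffOn I 𝓘(ℝ, K.model →L[ℝ] K.model) ∞
    (K.coordChange x₀ x₁) (K.nhd x₀ ∩ K.nhd x₁) := by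
  refine contMDiffOn_const.clm_comp (ContMDiffOn.clm_comp ?_
    (((K.smooth_T_inv x₀).mono Set.inter_subset_left).clm_comp contMDiffOn_const))
  exact K.smooth_g.contMDiffOn.coordChangeL (fun x hx => hx.1.1.1) (fun x hx => hx.2.1.1)

lemma coordChange_apply (x₀ x₁ : M) {x : M} (hx : x ∈ K.nhd x₀ ∩ K.nhd x₁) (w : K.model) :
    K.coordChange x₀ x₁ x w = (K.localTriv x₁ ⟨x, (K.localTriv x₀).symm x w⟩).2 := by
  rw [localTriv_symm K hx.1, localTriv_apply K hx.2]
  change K.compl x₁ ((trivializationAt Om.F Om.fib (K.g x₀)).coordChangeL ℝ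
    (trivializationAt Om.F Om.fib (K.g x₁)) (K.g x) ((K.T x₀ x).inverse (0, w))) = _
  rw [Trivialization.coordChangeL_apply _ _ ⟨hx.1.1.1, hx.2.1.1⟩]
  rfl

/-- The kernels as a vector bundle: around `x₀` the kernel of `A x` is identified with the model
fibre by the complementary map. -/
def prebundle : VectorPrebundle ℝ K.model K.Fib where
  pretrivializationAtlas := Set.range K.localTriv
  pretrivialization_linear' := by
    rintro _ ⟨x₀, rfl⟩
    refine ⟨fun x hx => ?_⟩
    have hx : x ∈ K.nhd x₀ := hx
    exact ⟨fun v w => by simp only [localTriv_apply K hx, Submodule.coe_add, map_add],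
      fun c v => by simp only [localTriv_apply K hx, Submodule.coe_smul, map_smul]⟩
  pretrivializationAt := K.localTriv
  mem_base_pretrivializationAt x := ⟨K.mem_base x, K.T_invertible x⟩
  pretrivialization_mem_atlas x := ⟨x, rfl⟩
  exists_coordChange := by
    rintro _ ⟨x₀, rfl⟩ _ ⟨x₁, rfl⟩
    exact ⟨K.coordChange x₀ x₁, (K.smooth_coordChange x₀ x₁).continuousOn,
      fun x hx w => K.coordChange_apply x₀ x₁ hx w⟩
  totalSpaceMk_isInducing := by
    intro x
    have hx : x ∈ K.nhd x := ⟨K.mem_base x, K.T_invertible x⟩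
    let q : K.Fib x → K.model := fun v => K.compl x (φ (K.nhd_base hx) v.1)
    have hq : Continuous q := (K.compl x).continuous.comp ((φ (K.nhd_base hx)).continuous.comp
      continuous_subtype_val)
    have hq' : Topology.IsInducing q := by
      have hr : Continuous (fun w : K.model =>
          (φ (K.nhd_base hx)).symm ((K.T x x).inverse (0, w))) :=
        (φ (K.nhd_base hx)).symm.continuous.comp ((K.T x x).inverse.continuous.comp
          (Continuous.prodMk continuous_const continuous_id))
      refine Topology.IsInducing.of_comp hq hr ?_
      have : (fun w : K.model => (φ (K.nhd_base hx)).symm ((K.T x x).inverse (0, w))) ∘ q =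
          (Subtype.val : K.Fib x → _) := by
        funext v
        simp only [Function.comp_apply, q]
        rw [← T_of_mem, inv_T _ hx, ContinuousLinearEquiv.symm_apply_apply]
      rw [this]
      exact Topology.IsInducing.subtypeVal
    exact Topology.isInducing_const_prod.2 hq'

lemma prebundle_smooth : K.prebundle.IsContMDiff I ∞ where
  exists_contMDiffCoordChange := by
    rintro _ ⟨x₀, rfl⟩ _ ⟨x₁, rfl⟩
    exact ⟨K.coordChange x₀ x₁, K.smooth_coordChange x₀ x₁,
      fun x hx w => K.coordChange_apply x₀ x₁ hx w⟩

/-- The kernel of a smooth family of surjective linear maps, as a smooth vector bundle. -/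
def bundle : SmoothVB I M :=
  letI := K.prebundle.totalSpaceTopology
  letI := K.prebundle.toFiberBundle
  letI := K.prebundle.toVectorBundle
  haveI := K.prebundle_smooth
  letI := K.prebundle.contMDiffVectorBundle (n := ∞) I
  { F := K.model, fib := K.Fib }

/-- The inclusion of the kernel bundle. -/
def incl (x : M) : K.bundle.fib x →L[ℝ] Om.fib (K.g x) := (K.fib x).subtypeL

/-- The kernel bundle carries the smooth structure inherited from the ambient bundle. -/
lemma contMDiff_incl : ContMDiff K.bundle.model Om.model ∞
    (fun v : K.bundle.Tot => (⟨K.g v.1, K.incl v.1 v.2⟩ : Om.Tot)) := by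
  intro v₀
  rw [contMDiffAt_totalSpace]
  have hp : ContMDiffAt K.bundle.model I ∞ (fun v : K.bundle.Tot => v.1) v₀ :=
    contMDiffAt_proj K.bundle.fib
  refine ⟨K.smooth_g.contMDiffAt.comp v₀ hp, ?_⟩
  set x₀ := v₀.1 with hx₀
  have hx : x₀ ∈ K.nhd x₀ := ⟨K.mem_base x₀, K.T_invertible x₀⟩
  have h1 : ContMDiffAt K.bundle.model 𝓘(ℝ, K.bundle.F) ∞
      (fun v : K.bundle.Tot => (trivializationAt K.bundle.F K.bundle.fib x₀ v).2) v₀ :=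
    (contMDiffAt_totalSpace.1 (contMDiffAt_id (x := v₀))).2
  have h1' : ContMDiffAt K.bundle.model 𝓘(ℝ, K.model) ∞
      (fun v : K.bundle.Tot => (K.localTriv x₀ v).2) v₀ := h1
  have h2 : ContMDiffAt K.bundle.model 𝓘(ℝ, B.F × K.model →L[ℝ] Om.F) ∞
      (fun v : K.bundle.Tot => (K.T x₀ v.1).inverse) v₀ :=
    ((K.smooth_T_inv x₀).contMDiffAt ((K.isOpen_nhd x₀).mem_nhds hx)).comp v₀ hp
  have h3 := h2.clm_apply ((ContinuousLinearMap.inr ℝ B.F K.model).contMDiff.contMDiffAt.comp v₀ h1')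
  refine h3.congr_of_eventuallyEq ?_
  filter_upwards [hp.continuousAt ((K.isOpen_nhd x₀).mem_nhds hx)] with v hv
  have hv : v.1 ∈ K.nhd x₀ := hv
  let w : K.fib v.1 := v.2
  change φ (K.nhd_base hv) w.1 = (K.T x₀ v.1).inverse (0, K.compl x₀ (φ (K.nhd_base hv) w.1))
  rw [← T_of_mem, inv_T _ hv]

/-- A smooth morphism of vector bundles has smooth matrices in local trivializations. -/
lemma smooth_coord (Om : SmoothVB I₁ N₁) (B : SmoothVB I₂ N₂) {s : N₁ → N₂}
    (A : ∀ y, Om.fib y →L[ℝ] B.fib (s y))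
    (hA : ContMDiff Om.model B.model ∞ (fun v : Om.Tot => (⟨s v.1, A v.1 v.2⟩ : B.Tot)))
    {g : M → N₁} (hg : ContMDiff I I₁ ∞ g) (x₀ : M) :
    ContMDiffOn I 𝓘(ℝ, Om.F →L[ℝ] B.F) ∞
    (fun x => ContinuousLinearMap.inCoordinates Om.F Om.fib B.F B.fib (g x₀) (g x)
      (s (g x₀)) (s (g x)) (A (g x)))
    (g ⁻¹' (trivializationAt Om.F Om.fib (g x₀)).baseSet ∩
      (fun x => s (g x)) ⁻¹' (trivializationAt B.F B.fib (s (g x₀))).baseSet) := by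
  set D := (g ⁻¹' (trivializationAt Om.F Om.fib (g x₀)).baseSet ∩
      (fun x => s (g x)) ⁻¹' (trivializationAt B.F B.fib (s (g x₀))).baseSet) with hD
  set L := fun x => ContinuousLinearMap.inCoordinates Om.F Om.fib B.F B.fib (g x₀) (g x)
      (s (g x₀)) (s (g x)) (A (g x)) with hL
  have key : ∀ v : Om.F, ContMDiffOn I 𝓘(ℝ, B.F) ∞ (fun x => L x v) D := by
    intro v
    have h1 : ContMDiffOn I Om.model ∞
        (fun x => (trivializationAt Om.F Om.fib (g x₀)).toOpenPartialHomeomorph.symm (g x, v)) D :=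
      ((trivializationAt Om.F Om.fib (g x₀)).contMDiffOn_symm (IB := I₁) (n := ∞)).comp
        (hg.contMDiffOn.prodMk contMDiffOn_const)
        (fun x hx => (Trivialization.mem_target _).2 hx.1)
    have h2 := hA.comp_contMDiffOn h1
    have h3 := ((trivializationAt B.F B.fib (s (g x₀))).contMDiffOn (IB := I₂) (n := ∞)).comp h2
      (fun x hx => by
        rw [Set.mem_preimage, Trivialization.mem_source]
        simp only [Function.comp_apply]
        rw [← Trivialization.mk_symm _ hx.1]
        exact hx.2)
    refine (contMDiff_snd.comp_contMDiffOn h3).congr (fun x hx => ?_)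
    simp only [Function.comp_apply]
    rw [← Trivialization.mk_symm _ hx.1]
    simp only [hL]
    rw [ContinuousLinearMap.inCoordinates_eq hx.1 hx.2]
    rfl
  let b := Module.finBasis ℝ Om.F
  have hsum : L = fun x => ∑ i, ContinuousLinearMap.smulRightL ℝ Om.F B.F
      (LinearMap.toContinuousLinearMap (b.coord i)) (L x (b i)) := by
    funext x
    ext v
    conv_lhs => rw [← b.sum_repr v]
    simp [-Module.Basis.sum_repr]
  rw [hsum]
  exact contMDiffOn_finsetSum (fun i _ => (ContinuousLinearMap.contMDiff _).comp_contMDiffOn (key (b i)))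

end SurjFamily
end KernelBundle

section Groupoids

variable {EG HG EP HP : Type*}
  [NormedAddCommGroup EG] [NormedSpace ℝ EG] [TopologicalSpace HG]
  [NormedAddCommGroup EP] [NormedSpace ℝ EP] [TopologicalSpace HP]
  {I : ModelWithCorners ℝ EG HG} {J : ModelWithCorners ℝ EP HP}
  {G P : Type*} [TopologicalSpace G] [ChartedSpace HG G] [TopologicalSpace P] [ChartedSpace HP P]

/-- The structure maps of a groupoid with arrows `G` and objects `P`. The product `mul g h` is
meaningful only if `src g = tgt h`; its other values are never used. -/
structure GroupoidData (G P : Type*) where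
  src : G → P
  tgt : G → P
  one : P → G
  inv : G → G
  mul : G → G → G

/-- The structure maps are those of a Lie groupoid: the groupoid laws hold, all structure maps are
smooth, and source and target are submersions. The composable pairs form an embedded submanifold
of `G × G`, on which the product is required to be smooth. -/
structure GroupoidData.IsLieGroupoid (S : GroupoidData G P) (I : ModelWithCorners ℝ EG HG)
    (J : ModelWithCorners ℝ EP HP) : Prop where
  src_one : ∀ p, S.src (S.one p) = p
  tgt_one : ∀ p, S.tgt (S.one p) = p
  src_mul : ∀ g h, S.src g = S.tgt h → S.src (S.mul g h) = S.src h
  tgt_mul : ∀ g h, S.src g = S.tgt h → S.tgt (S.mul g h) = S.tgt g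
  mul_assoc : ∀ g h k, S.src g = S.tgt h → S.src h = S.tgt k →
    S.mul (S.mul g h) k = S.mul g (S.mul h k)
  one_mul : ∀ g, S.mul (S.one (S.tgt g)) g = g
  mul_one : ∀ g, S.mul g (S.one (S.src g)) = g
  src_inv : ∀ g, S.src (S.inv g) = S.tgt g
  tgt_inv : ∀ g, S.tgt (S.inv g) = S.src g
  inv_mul : ∀ g, S.mul (S.inv g) g = S.one (S.src g)
  mul_inv : ∀ g, S.mul g (S.inv g) = S.one (S.tgt g)
  contMDiff_src : ContMDiff I J ∞ S.src
  contMDiff_tgt : ContMDiff I J ∞ S.tgt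
  contMDiff_one : ContMDiff J I ∞ S.one
  contMDiff_inv : ContMDiff I I ∞ S.inv
  contMDiff_mul : ContMDiffOn (I.prod I) I ∞ (fun x : G × G => S.mul x.1 x.2)
    {x : G × G | S.src x.1 = S.tgt x.2}
  submersion_src : ∀ g, Function.Surjective (mfderiv I J S.src g)
  submersion_tgt : ∀ g, Function.Surjective (mfderiv I J S.tgt g)

/-- A Lie groupoid with arrow manifold `G` and object manifold `P`. -/
structure LieGroupoid (I : ModelWithCorners ℝ EG HG) (J : ModelWithCorners ℝ EP HP) (G P : Type*)
    [TopologicalSpace G] [ChartedSpace HG G] [TopologicalSpace P] [ChartedSpace HP P]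
    extends GroupoidData G P where
  isLieGroupoid : toGroupoidData.IsLieGroupoid I J

variable {S : LieGroupoid I J G P}

/-- Structure maps on a vector bundle `Om` over `G` and a vector bundle `B` over `P` which cover
those of the groupoid `S`. Source, target and identity are linear on the fibres. -/
structure VBGroupoidData (S : LieGroupoid I J G P) (Om : SmoothVB I G) (B : SmoothVB J P) where
  src : ∀ γ, Om.fib γ →L[ℝ] B.fib (S.src γ)
  tgt : ∀ γ, Om.fib γ →L[ℝ] B.fib (S.tgt γ)
  one : ∀ p, B.fib p →L[ℝ] Om.fib (S.one p)
  inv : ∀ γ, Om.fib γ → Om.fib (S.inv γ)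
  mul : ∀ γ δ, Om.fib γ → Om.fib δ → Om.fib (S.mul γ δ)

/-- The induced structure maps on the total spaces. -/
def VBGroupoidData.total {Om : SmoothVB I G} {B : SmoothVB J P} (V : VBGroupoidData S Om B) :
    GroupoidData Om.Tot B.Tot where
  src ξ := ⟨S.src ξ.1, V.src ξ.1 ξ.2⟩
  tgt ξ := ⟨S.tgt ξ.1, V.tgt ξ.1 ξ.2⟩
  one b := ⟨S.one b.1, V.one b.1 b.2⟩
  inv ξ := ⟨S.inv ξ.1, V.inv ξ.1 ξ.2⟩
  mul ξ η := ⟨S.mul ξ.1 η.1, V.mul ξ.1 η.1 ξ.2 η.2⟩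

/-- A VB-groupoid `(Om; B, G; P)`: the total spaces form a Lie groupoid over `S`, the structure
maps are morphisms of vector bundles, and the map from `Om` to `B ×_P G` given by source and
projection is a surjective submersion. The tangent space of the submanifold `B ×_P G` of `B × G`
at a point `(b, γ)` consists of the pairs `(v, w)` of tangent vectors with equal images in `P`. -/
structure VBGroupoid (S : LieGroupoid I J G P) (Om : SmoothVB I G) (B : SmoothVB J P)
    extends VBGroupoidData S Om B where
  isLieGroupoid : toVBGroupoidData.total.IsLieGroupoid Om.model B.model
  mul_add : ∀ γ δ (ξ₁ ξ₂ : Om.fib γ) (η₁ η₂ : Om.fib δ),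
    toVBGroupoidData.total.src ⟨γ, ξ₁⟩ = toVBGroupoidData.total.tgt ⟨δ, η₁⟩ →
    toVBGroupoidData.total.src ⟨γ, ξ₂⟩ = toVBGroupoidData.total.tgt ⟨δ, η₂⟩ →
    mul γ δ (ξ₁ + ξ₂) (η₁ + η₂) = mul γ δ ξ₁ η₁ + mul γ δ ξ₂ η₂
  mul_smul : ∀ γ δ (c : ℝ) (ξ : Om.fib γ) (η : Om.fib δ),
    toVBGroupoidData.total.src ⟨γ, ξ⟩ = toVBGroupoidData.total.tgt ⟨δ, η⟩ →
    mul γ δ (c • ξ) (c • η) = c • mul γ δ ξ η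
  src_proj_surjective : ∀ (b : B.Tot) (γ : G), b.proj = S.src γ →
    ∃ ξ : Om.Tot, toVBGroupoidData.total.src ξ = b ∧ ξ.proj = γ
  src_proj_submersion : ∀ (ξ : Om.Tot)
    (v : TangentSpace B.model (toVBGroupoidData.total.src ξ)) (w : TangentSpace I ξ.proj),
    (mfderiv B.model J (TotalSpace.proj : B.Tot → P) (toVBGroupoidData.total.src ξ) v : EP) =
      mfderiv I J S.src ξ.proj w →
    ∃ u : TangentSpace Om.model ξ,
      mfderiv Om.model B.model toVBGroupoidData.total.src ξ u = v ∧
      mfderiv Om.model I (TotalSpace.proj : Om.Tot → G) ξ u = w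

namespace VBGroupoid

variable {Om Om' : SmoothVB I G} {B B' : SmoothVB J P}

lemma src_surjective (V : VBGroupoid S Om B) (γ : G) : Function.Surjective (V.src γ) := by
  intro b
  obtain ⟨⟨γ', ξ⟩, h, hγ⟩ := V.src_proj_surjective ⟨S.src γ, b⟩ γ rfl
  obtain rfl : γ' = γ := hγ
  exact ⟨ξ, eq_of_heq (TotalSpace.mk.inj h).2⟩

/-- The source maps on the fibres over the identity arrows. -/
def coreFamily (V : VBGroupoid S Om B) : KernelBundle.SurjFamily J P Om B where
  g := S.one
  f p := S.src (S.one p)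
  A p := V.src (S.one p)
  smooth_g := S.isLieGroupoid.contMDiff_one
  smooth_f := S.isLieGroupoid.contMDiff_src.comp S.isLieGroupoid.contMDiff_one
  surj p := V.src_surjective (S.one p)
  smooth_A p := KernelBundle.SurjFamily.smooth_coord Om B V.src V.isLieGroupoid.contMDiff_src
    S.isLieGroupoid.contMDiff_one p

/-- The core: the vector bundle over `P` whose fibre at `p` consists of the elements of `Om` over
the identity arrow at `p` with source zero. -/
def core (V : VBGroupoid S Om B) : SmoothVB J P := V.coreFamily.bundle

/-- The inclusion of the core. -/
def coreIncl (V : VBGroupoid S Om B) (p : P) : V.core.fib p →L[ℝ] Om.fib (S.one p) :=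
  V.coreFamily.incl p

lemma src_coreIncl (V : VBGroupoid S Om B) (p : P) (k : V.core.fib p) :
    V.src (S.one p) (V.coreIncl p k) = 0 :=
  (show V.coreFamily.fib p from k).2

/-- A pair of families of linear maps is a morphism of VB-groupoids over the identity of `S`. -/
structure IsMorphism (V : VBGroupoid S Om B) (V' : VBGroupoid S Om' B') (F : Om.FibHom Om')
    (f : B.FibHom B') : Prop where
  morphism_total : F.IsMorphism
  morphism_side : f.IsMorphism
  map_src : ∀ γ (ξ : Om.fib γ), V'.src γ (F γ ξ) = f (S.src γ) (V.src γ ξ)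
  map_tgt : ∀ γ (ξ : Om.fib γ), V'.tgt γ (F γ ξ) = f (S.tgt γ) (V.tgt γ ξ)
  map_one : ∀ p (b : B.fib p), F (S.one p) (V.one p b) = V'.one p (f p b)
  map_mul : ∀ γ δ (ξ : Om.fib γ) (η : Om.fib δ), V.total.src ⟨γ, ξ⟩ = V.total.tgt ⟨δ, η⟩ →
    F (S.mul γ δ) (V.mul γ δ ξ η) = V'.mul γ δ (F γ ξ) (F δ η)

/-- The restriction of a morphism of VB-groupoids to the cores. -/
def IsMorphism.core {V : VBGroupoid S Om B} {V' : VBGroupoid S Om' B'} {F : Om.FibHom Om'}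
    {f : B.FibHom B'} (h : IsMorphism V V' F f) : V.core.FibHom V'.core := fun p =>
  ((F (S.one p)).comp (V.coreIncl p)).codRestrict (V'.coreFamily.fib p) (fun k => by
    have h1 := h.map_src (S.one p) (V.coreIncl p k)
    rw [V.src_coreIncl, map_zero] at h1
    exact h1)

/-- `W` is the dual VB-groupoid of `V`: a VB-groupoid `(Om*; K*, G; P)`, with `K` the core of `V`,
whose target, source, product and identity are determined by
`⟨tgt Φ, k⟩ = ⟨Φ, k 0_γ⟩`, `⟨src Φ, k⟩ = ⟨Φ, -(0_γ k⁻¹)⟩`, `⟨Ψ Φ, η ξ⟩ = ⟨Ψ, η⟩ + ⟨Φ, ξ⟩` and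
`⟨1_χ, 1_b + k⟩ = ⟨χ, k⟩`. The products `k 0_γ` and `0_γ k⁻¹` lie in `Om_γ`; they are expressed as
elements `ξ` of this fibre. -/
structure IsDual (V : VBGroupoid S Om B) (W : VBGroupoid S Om.dual V.core.dual) : Prop where
  pair_tgt : ∀ γ (Φ : Om.dual.fib γ) (k : V.core.fib (S.tgt γ)) (ξ : Om.fib γ),
    (⟨γ, ξ⟩ : Om.Tot) = V.total.mul ⟨S.one (S.tgt γ), V.coreIncl (S.tgt γ) k⟩ ⟨γ, 0⟩ →
    V.core.pair (W.tgt γ Φ) k = Om.pair Φ ξ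
  pair_src : ∀ γ (Φ : Om.dual.fib γ) (k : V.core.fib (S.src γ)) (ξ : Om.fib γ),
    (⟨γ, ξ⟩ : Om.Tot) =
      V.total.mul ⟨γ, 0⟩ (V.total.inv ⟨S.one (S.src γ), V.coreIncl (S.src γ) k⟩) →
    V.core.pair (W.src γ Φ) k = Om.pair Φ (-ξ)
  pair_mul : ∀ δ γ (Ψ : Om.dual.fib δ) (Φ : Om.dual.fib γ) (η : Om.fib δ) (ξ : Om.fib γ),
    W.total.src ⟨δ, Ψ⟩ = W.total.tgt ⟨γ, Φ⟩ → V.total.src ⟨δ, η⟩ = V.total.tgt ⟨γ, ξ⟩ →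
    Om.pair (W.mul δ γ Ψ Φ) (V.mul δ γ η ξ) = Om.pair Ψ η + Om.pair Φ ξ
  pair_one : ∀ p (χ : V.core.dual.fib p) (b : B.fib p) (k : V.core.fib p),
    Om.pair (W.one p χ) (V.one p b + V.coreIncl p k) = V.core.pair χ k

variable {Om₁ Om₂ Om₃ : SmoothVB I G} {B₁ B₂ B₃ : SmoothVB J P}

/-- A short exact sequence of VB-groupoids over `S`: two morphisms of VB-groupoids over the
identity of `S` such that `Om₁ → Om₂ → Om₃` is a short exact sequence of vector bundles over
`G`. -/
structure IsShortExact (V₁ : VBGroupoid S Om₁ B₁) (V₂ : VBGroupoid S Om₂ B₂)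
    (V₃ : VBGroupoid S Om₃ B₃) (F : Om₁.FibHom Om₂) (f : B₁.FibHom B₂) (H : Om₂.FibHom Om₃)
    (h : B₂.FibHom B₃) : Prop where
  morphism_left : IsMorphism V₁ V₂ F f
  morphism_right : IsMorphism V₂ V₃ H h
  exact_total : SmoothVB.IsShortExact F H

end VBGroupoid

end Groupoids

end

/-! The dual product is forced by linear algebra. Three facts about `Om` carry it: every vector over
`δγ` is a product `ηξ` (`exists_mul_eq`); a composable pair with product zero has the form `(0_δ
k⁻¹, k 0_γ)` for one core element `k` (`exists_of_mul_eq_zero`); every vector over an identity arrow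
is `1_b + k` (`exists_one_tadd_inc`). The form `(η, ξ) ↦ ⟨Ψ, η⟩ + ⟨Φ, ξ⟩` on composable pairs
descends along multiplication if it vanishes on the pairs with product zero, and that is what
equality of the source of `Ψ` and the target of `Φ` says (`exists_isDualMul`). The groupoid laws of
the dual are checked by evaluating covectors on suitable factorizations; the inverse is `θ ↦ -⟨Φ,
θ⁻¹⟩`, and the main computation is `dual_inv_mul`.

For smoothness, a map into a dual bundle is tested against smooth maps into the bundle
(`contMDiffWithinAt_dual`). The factorizations used in the tests can be chosen smoothly, because a
smooth family of surjective maps has smooth local lifts (`exists_lift`). The source and target of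
the dual are adjoint to the injective maps `k ↦ -0_γ k⁻¹` and `k ↦ k 0_γ`, hence fibrewise
surjective, and fibrewise surjectivity gives the submersion property (`exists_tangent`).

For exactness, the identity inclusion and the source make `B` a natural retract of `Om` over the
identity arrows, and exactness passes to retracts (`IsShortExact.side`). The cores are the kernels
of the source maps between two exact rows, so they form an exact row because the source of the first
VB-groupoid is fibrewise surjective (`IsShortExact.core`). Dualizing a short exact sequence of
vector bundles keeps it exact, and the dual of a morphism respects the dual structure maps because
the original one commutes with translations, core projections and products (`IsMorphism.dual`). -/

noncomputable section

/-! ### Fibres, operations on total spaces, and the pairing with covectors. -/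

namespace SmoothVB

variable {E H : Type*} [NormedAddCommGroup E] [NormedSpace ℝ E] [TopologicalSpace H]
  {I : ModelWithCorners ℝ E H} {M : Type*} [TopologicalSpace M] [ChartedSpace H M]
  {E' H' : Type*} [NormedAddCommGroup E'] [NormedSpace ℝ E'] [TopologicalSpace H']
  {I' : ModelWithCorners ℝ E' H'} {M' : Type*} [TopologicalSpace M'] [ChartedSpace H' M']
  {EN HN : Type*} [NormedAddCommGroup EN] [NormedSpace ℝ EN] [TopologicalSpace HN]
  {IN : ModelWithCorners ℝ EN HN} {N : Type*} [TopologicalSpace N] [ChartedSpace HN N]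

/-- The local trivialization around `x₀` as an isomorphism of the fibre over `x₀`. -/
def fibEquiv (V : SmoothVB I M) (x : M) : V.fib x ≃L[ℝ] V.F :=
  (trivializationAt V.F V.fib x).continuousLinearEquivAt ℝ x
    (FiberBundle.mem_baseSet_trivializationAt' x)

instance (V : SmoothVB I M) (x : M) : FiniteDimensional ℝ (V.fib x) :=
  (V.fibEquiv x).symm.toLinearEquiv.finiteDimensional

/-- A linear map between fibres of vector bundles is continuous. -/
def toCLM (V : SmoothVB I M) (W : SmoothVB I' M') {x : M} {y : M'} (l : V.fib x →ₗ[ℝ] W.fib y) :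
    V.fib x →L[ℝ] W.fib y :=
  ((W.fibEquiv y).symm : W.F →L[ℝ] W.fib y) ∘L
    (LinearMap.toContinuousLinearMap ((W.fibEquiv y).toLinearMap ∘ₗ l ∘ₗ
      ((V.fibEquiv x).symm : V.F →L[ℝ] V.fib x).toLinearMap)) ∘L
    ((V.fibEquiv x) : V.fib x →L[ℝ] V.F)

@[simp] lemma toCLM_apply (V : SmoothVB I M) (W : SmoothVB I' M') {x : M} {y : M'}
    (l : V.fib x →ₗ[ℝ] W.fib y) (v : V.fib x) : toCLM V W l v = l v := by
  simp [toCLM]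

/-- A linear form on a fibre, as an element of the dual bundle. -/
def toDual (V : SmoothVB I M) {x : M} (l : V.fib x →ₗ[ℝ] ℝ) : V.dual.fib x :=
  show V.fib x →L[ℝ] ℝ from (LinearMap.toContinuousLinearMap (l ∘ₗ
      ((V.fibEquiv x).symm : V.F →L[ℝ] V.fib x).toLinearMap)) ∘L
    ((V.fibEquiv x) : V.fib x →L[ℝ] V.F)

@[simp] lemma pair_toDual (V : SmoothVB I M) {x : M} (l : V.fib x →ₗ[ℝ] ℝ) (v : V.fib x) :
    V.pair (V.toDual l) v = l v := by
  change l ((V.fibEquiv x).symm (V.fibEquiv x v)) = _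
  simp

lemma dual_ext (V : SmoothVB I M) {x : M} {Φ Ψ : V.dual.fib x}
    (h : ∀ v, V.pair Φ v = V.pair Ψ v) : Φ = Ψ :=
  ContinuousLinearMap.ext h

section pair
variable (V : SmoothVB I M) {x : M}
lemma pair_add (Φ : V.dual.fib x) (v w : V.fib x) : V.pair Φ (v + w) = V.pair Φ v + V.pair Φ w :=
  ContinuousLinearMap.map_add (show V.fib x →L[ℝ] ℝ from Φ) v w
lemma pair_neg (Φ : V.dual.fib x) (v : V.fib x) : V.pair Φ (-v) = -V.pair Φ v :=
  ContinuousLinearMap.map_neg (show V.fib x →L[ℝ] ℝ from Φ) v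
lemma pair_sub (Φ : V.dual.fib x) (v w : V.fib x) : V.pair Φ (v - w) = V.pair Φ v - V.pair Φ w :=
  ContinuousLinearMap.map_sub (show V.fib x →L[ℝ] ℝ from Φ) v w
lemma pair_zero (Φ : V.dual.fib x) : V.pair Φ 0 = 0 :=
  ContinuousLinearMap.map_zero (show V.fib x →L[ℝ] ℝ from Φ)
lemma pair_smul (Φ : V.dual.fib x) (c : ℝ) (v : V.fib x) : V.pair Φ (c • v) = c * V.pair Φ v :=
  ContinuousLinearMap.map_smul (show V.fib x →L[ℝ] ℝ from Φ) c v
lemma add_pair (Φ Ψ : V.dual.fib x) (v : V.fib x) :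
    V.pair (Φ + Ψ) v = V.pair Φ v + V.pair Ψ v := rfl
lemma smul_pair (c : ℝ) (Φ : V.dual.fib x) (v : V.fib x) : V.pair (c • Φ) v = c * V.pair Φ v := rfl
lemma zero_pair (v : V.fib x) : V.pair (0 : V.dual.fib x) v = 0 := rfl
end pair

open Classical in
/-- The element of the fibre over `x` given by a point of the total space over `x`. -/
def fibAt (V : SmoothVB I M) (x : M) (ξ : V.Tot) : V.fib x :=
  if h : ξ.1 = x then h ▸ ξ.2 else 0

@[simp] lemma fibAt_mk (V : SmoothVB I M) (x : M) (v : V.fib x) :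
    V.fibAt x (⟨x, v⟩ : V.Tot) = v := by
  simp [fibAt]

lemma mk_fibAt (V : SmoothVB I M) {x : M} {ξ : V.Tot} (h : ξ.1 = x) :
    (⟨x, V.fibAt x ξ⟩ : V.Tot) = ξ := by
  obtain ⟨y, v⟩ := ξ
  obtain rfl : y = x := h
  simp

lemma exists_mk (V : SmoothVB I M) {x : M} {ξ : V.Tot} (h : ξ.1 = x) :
    ∃ v : V.fib x, ξ = ⟨x, v⟩ := ⟨_, (V.mk_fibAt h).symm⟩

lemma mk_inj (V : SmoothVB I M) {x : M} {v w : V.fib x} :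
    (⟨x, v⟩ : V.Tot) = ⟨x, w⟩ ↔ v = w :=
  ⟨fun h => eq_of_heq (TotalSpace.mk.inj h).2, fun h => by rw [h]⟩

/-- The zero vector over `x`. -/
def zero (V : SmoothVB I M) (x : M) : V.Tot := ⟨x, 0⟩

/-- The sum of two vectors in the same fibre. -/
def tadd (V : SmoothVB I M) (ξ η : V.Tot) : V.Tot := ⟨ξ.1, ξ.2 + V.fibAt ξ.1 η⟩

/-- The difference of two vectors in the same fibre. -/
def tsub (V : SmoothVB I M) (ξ η : V.Tot) : V.Tot := ⟨ξ.1, ξ.2 - V.fibAt ξ.1 η⟩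

/-- The multiple of a vector. -/
def tsmul (V : SmoothVB I M) (c : ℝ) (ξ : V.Tot) : V.Tot := ⟨ξ.1, c • ξ.2⟩

/-- The pairing of a covector and a vector over the same point. -/
def ev (V : SmoothVB I M) (Φ : V.dual.Tot) (ξ : V.Tot) : ℝ := V.pair Φ.2 (V.fibAt Φ.1 ξ)

variable {V : SmoothVB I M} {W : SmoothVB I' M'}

@[simp] lemma tadd_mk (x : M) (v w : V.fib x) :
    V.tadd (⟨x, v⟩ : V.Tot) ⟨x, w⟩ = ⟨x, v + w⟩ := by simp [tadd]
@[simp] lemma tsub_mk (x : M) (v w : V.fib x) :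
    V.tsub (⟨x, v⟩ : V.Tot) ⟨x, w⟩ = ⟨x, v - w⟩ := by simp [tsub]
@[simp] lemma tsmul_mk (x : M) (c : ℝ) (v : V.fib x) :
    V.tsmul c (⟨x, v⟩ : V.Tot) = ⟨x, c • v⟩ := rfl
@[simp] lemma ev_mk (x : M) (Φ : V.dual.fib x) (v : V.fib x) :
    V.ev (⟨x, Φ⟩ : V.dual.Tot) ⟨x, v⟩ = V.pair Φ v := by simp [ev]

/-- The test vectors are points of the total space, so covectors over base points that are only
provably equal are compared without transport. The groupoid laws of the dual are proved this way. -/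
lemma tot_dual_ext {Φ Ψ : V.dual.Tot} (h : Φ.1 = Ψ.1)
    (h' : ∀ ξ : V.Tot, ξ.1 = Φ.1 → V.ev Φ ξ = V.ev Ψ ξ) : Φ = Ψ := by
  obtain ⟨x, Φ⟩ := Φ
  obtain ⟨y, Ψ⟩ := Ψ
  obtain rfl : x = y := h
  congr 1
  refine V.dual_ext fun v => ?_
  simpa using h' ⟨x, v⟩ rfl

/-! ### Smoothness of maps into vector bundles -/

lemma contMDiffWithinAt_pair {b : N → M} {Φ : ∀ x, V.dual.fib (b x)} {v : ∀ x, V.fib (b x)}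
    {s : Set N} {x₀ : N}
    (hΦ : ContMDiffWithinAt IN V.dual.model ∞ (fun x => (⟨b x, Φ x⟩ : V.dual.Tot)) s x₀)
    (hv : ContMDiffWithinAt IN V.model ∞ (fun x => (⟨b x, v x⟩ : V.Tot)) s x₀) :
    ContMDiffWithinAt IN 𝓘(ℝ, ℝ) ∞ (fun x => V.pair (Φ x) (v x)) s x₀ := by
  have h := ContMDiffWithinAt.clm_bundle_apply (F₂ := ℝ) (E₂ := Bundle.Trivial M ℝ)
    (IB := I) hΦ hv
  exact (contMDiffWithinAt_totalSpace.1 h).2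

lemma contMDiffWithinAt_ev {Φ : N → V.dual.Tot} {v : N → V.Tot} {s : Set N} {x₀ : N}
    (hΦ : ContMDiffWithinAt IN V.dual.model ∞ Φ s x₀)
    (hv : ContMDiffWithinAt IN V.model ∞ v s x₀)
    (hb : ∀ x ∈ s, (v x).1 = (Φ x).1) (hb₀ : (v x₀).1 = (Φ x₀).1) :
    ContMDiffWithinAt IN 𝓘(ℝ, ℝ) ∞ (fun x => V.ev (Φ x) (v x)) s x₀ :=
  contMDiffWithinAt_pair (b := fun x => (Φ x).1) (Φ := fun x => (Φ x).2)
    (v := fun x => V.fibAt (Φ x).1 (v x)) hΦ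
    (hv.congr (fun x hx => V.mk_fibAt (hb x hx)) (V.mk_fibAt hb₀))

/-- A vector depending on the base point, constant in the trivialization around `x₀`. -/
def constSec (V : SmoothVB I M) (x₀ : M) (w : V.F) (x : M) : V.Tot :=
  ⟨x, (trivializationAt V.F V.fib x₀).symm x w⟩

lemma contMDiffWithinAt_constSec {b : N → M} {w : N → V.F} {x₁ : M} {s : Set N} {x₀ : N}
    (hb : ContMDiffWithinAt IN I ∞ b s x₀) (hw : ContMDiffWithinAt IN 𝓘(ℝ, V.F) ∞ w s x₀)
    (h : b x₀ ∈ (trivializationAt V.F V.fib x₁).baseSet) :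
    ContMDiffWithinAt IN V.model ∞ (fun x => V.constSec x₁ (w x) (b x)) s x₀ := by
  have h1 := ((trivializationAt V.F V.fib x₁).contMDiffOn_symm (IB := I) (n := ∞))
  have h2 : ContMDiffAt V.model V.model ∞
      (trivializationAt V.F V.fib x₁).toOpenPartialHomeomorph.symm (b x₀, w x₀) :=
    h1.contMDiffAt ((trivializationAt V.F V.fib x₁).open_target.mem_nhds
      ((Trivialization.mem_target _).2 h))
  have h3 := h2.comp_contMDiffWithinAt x₀ (hb.prodMk hw)
  refine h3.congr_of_eventuallyEq ?_ ?_
  · filter_upwards [hb.continuousWithinAt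
      ((trivializationAt V.F V.fib x₁).open_baseSet.mem_nhds h)] with x hx
    exact Trivialization.mk_symm _ hx _
  · exact Trivialization.mk_symm _ h _

/-- Pairing with sections that are constant in the trivialization around `(Φ x₀).1` gives the
coordinates of `Φ`, and a basis of the model fibre supplies finitely many such sections. The
smoothness of each structure map of the dual is reduced to this test. -/
lemma contMDiffWithinAt_dual {Φ : N → V.dual.Tot} {s : Set N} {x₀ : N}
    (hb : ContMDiffWithinAt IN I ∞ (fun x => (Φ x).1) s x₀)
    (h : ∀ v : N → V.Tot, ContMDiffWithinAt IN V.model ∞ v s x₀ → (∀ x, (v x).1 = (Φ x).1) →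
      ContMDiffWithinAt IN 𝓘(ℝ, ℝ) ∞ (fun x => V.ev (Φ x) (v x)) s x₀) :
    ContMDiffWithinAt IN V.dual.model ∞ Φ s x₀ := by
  refine (contMDiffWithinAt_hom_bundle (F₁ := V.F) (E₁ := V.fib) (F₂ := ℝ)
    (E₂ := Bundle.Trivial M ℝ) (IB := I) Φ).2 ⟨hb, ?_⟩
  set L : N → V.F →L[ℝ] ℝ := fun x => ContinuousLinearMap.inCoordinates V.F V.fib ℝ
    (Bundle.Trivial M ℝ) (Φ x₀).1 (Φ x).1 (Φ x₀).1 (Φ x).1 (Φ x).2 with hL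
  have key : ∀ w : V.F, ContMDiffWithinAt IN 𝓘(ℝ, ℝ) ∞ (fun x => L x w) s x₀ := by
    intro w
    have hm := FiberBundle.mem_baseSet_trivializationAt' (F := V.F) (E := V.fib) (Φ x₀).1
    have h2 := h (fun x => V.constSec (Φ x₀).1 w (Φ x).1)
      (contMDiffWithinAt_constSec hb contMDiffWithinAt_const hm) (fun _ => rfl)
    have hc : ∀ x, (Φ x).1 ∈ (trivializationAt V.F V.fib (Φ x₀).1).baseSet →
        L x w = V.ev (Φ x) (V.constSec (Φ x₀).1 w (Φ x).1) := by
      intro x hx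
      have h3 := ContinuousLinearMap.inCoordinates_eq (F' := ℝ) (E' := Bundle.Trivial M ℝ)
        (y₀ := (Φ x₀).1) (y := (Φ x).1) (ϕ := (Φ x).2) hx (by simp)
      simp only [constSec, ev, fibAt_mk]
      exact congrArg (fun l : V.F →L[ℝ] ℝ => l w) h3
    refine h2.congr_of_eventuallyEq ?_ (hc x₀ hm)
    filter_upwards [hb.continuousWithinAt
      ((trivializationAt V.F V.fib (Φ x₀).1).open_baseSet.mem_nhds hm)] with x hx
    exact hc x hx
  let b := Module.finBasis ℝ V.F
  have hsum : L = fun x => ∑ i, ContinuousLinearMap.smulRightL ℝ V.F ℝ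
      (LinearMap.toContinuousLinearMap (b.coord i)) (L x (b i)) := by
    funext x
    ext v
    conv_lhs => rw [← b.sum_repr v]
    simp [-Module.Basis.sum_repr]
  change ContMDiffWithinAt IN 𝓘(ℝ, V.F →L[ℝ] ℝ) ∞ L s x₀
  rw [hsum]
  exact contMDiffWithinAt_finsetSum (fun i _ =>
    (ContinuousLinearMap.contMDiff _).contMDiffAt.comp_contMDiffWithinAt x₀ (key (b i)))

lemma contMDiffWithinAt_tsub {v w : N → V.Tot} {s : Set N} {x₀ : N}
    (hv : ContMDiffWithinAt IN V.model ∞ v s x₀) (hw : ContMDiffWithinAt IN V.model ∞ w s x₀)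
    (hb : ∀ x ∈ s, (w x).1 = (v x).1) (hb₀ : (w x₀).1 = (v x₀).1) :
    ContMDiffWithinAt IN V.model ∞ (fun x => V.tsub (v x) (w x)) s x₀ := by
  have hw' : ContMDiffWithinAt IN V.model ∞
      (fun x => (⟨(v x).1, V.fibAt (v x).1 (w x)⟩ : V.Tot)) s x₀ :=
    hw.congr (fun x hx => V.mk_fibAt (hb x hx)) (V.mk_fibAt hb₀)
  rw [contMDiffWithinAt_totalSpace] at hv hw' ⊢
  refine ⟨hv.1, ?_⟩
  have hm := FiberBundle.mem_baseSet_trivializationAt' (F := V.F) (E := V.fib) (v x₀).1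
  have hc : ∀ x, (v x).1 ∈ (trivializationAt V.F V.fib (v x₀).1).baseSet →
      (trivializationAt V.F V.fib (v x₀).1 (V.tsub (v x) (w x))).2 =
      (trivializationAt V.F V.fib (v x₀).1 (v x)).2 -
      (trivializationAt V.F V.fib (v x₀).1 ⟨(v x).1, V.fibAt (v x).1 (w x)⟩).2 := by
    intro x hx
    exact ((trivializationAt V.F V.fib (v x₀).1).continuousLinearEquivAt ℝ (v x).1 hx).map_sub _ _
  refine (hv.2.sub hw'.2).congr_of_eventuallyEq ?_ (hc x₀ hm)
  filter_upwards [hv.1.continuousWithinAt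
      ((trivializationAt V.F V.fib (v x₀).1).open_baseSet.mem_nhds hm)] with x hx
  exact hc x hx

lemma contMDiff_zero : ContMDiff I V.model ∞ V.zero := contMDiff_zeroSection ℝ V.fib

end SmoothVB

/-! ### Smooth lifts along fibrewise surjective maps, and the resulting submersions. -/

namespace KernelBundle

variable {E H : Type*} [NormedAddCommGroup E] [NormedSpace ℝ E] [TopologicalSpace H]
  {I : ModelWithCorners ℝ E H} {M : Type*} [TopologicalSpace M] [ChartedSpace H M]
  {E₁ H₁ : Type*} [NormedAddCommGroup E₁] [NormedSpace ℝ E₁] [TopologicalSpace H₁]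
  {I₁ : ModelWithCorners ℝ E₁ H₁} {N₁ : Type*} [TopologicalSpace N₁] [ChartedSpace H₁ N₁]
  {E₂ H₂ : Type*} [NormedAddCommGroup E₂] [NormedSpace ℝ E₂] [TopologicalSpace H₂]
  {I₂ : ModelWithCorners ℝ E₂ H₂} {N₂ : Type*} [TopologicalSpace N₂] [ChartedSpace H₂ N₂]
  {EN HN : Type*} [NormedAddCommGroup EN] [NormedSpace ℝ EN] [TopologicalSpace HN]
  {IN : ModelWithCorners ℝ EN HN} {N : Type*} [TopologicalSpace N] [ChartedSpace HN N]

variable {Om : SmoothVB I₁ N₁} {B : SmoothVB I₂ N₂} (K : SurjFamily I M Om B)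

namespace SurjFamily

/-- A map into the kernel bundle is smooth if it is smooth as a map into the ambient bundle. -/
lemma contMDiffWithinAt_of_incl {k : N → K.bundle.Tot} {s : Set N} {x₀ : N}
    (hb : ContMDiffWithinAt IN I ∞ (fun x => (k x).1) s x₀)
    (hi : ContMDiffWithinAt IN Om.model ∞
      (fun x => (⟨K.g (k x).1, K.incl (k x).1 (k x).2⟩ : Om.Tot)) s x₀) :
    ContMDiffWithinAt IN K.bundle.model ∞ k s x₀ := by
  rw [contMDiffWithinAt_totalSpace]
  refine ⟨hb, ?_⟩
  exact (K.compl (k x₀).1).contMDiff.contMDiffAt.comp_contMDiffWithinAt x₀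
    (contMDiffWithinAt_totalSpace.1 hi).2

/-- Smooth local lifts along a smooth family of surjective linear maps. -/
lemma exists_lift {γ : N → M} {b : N → B.Tot} {s : Set N} {x₀ : N}
    (hγ : ContMDiffWithinAt IN I ∞ γ s x₀) (hb : ContMDiffWithinAt IN B.model ∞ b s x₀)
    (hs : ∀ x ∈ s, (b x).1 = K.f (γ x)) (ξ₀ : Om.fib (K.g (γ x₀)))
    (h₀ : (⟨K.f (γ x₀), K.A (γ x₀) ξ₀⟩ : B.Tot) = b x₀) :
    ∃ ξ : N → Om.Tot, ContMDiffWithinAt IN Om.model ∞ ξ s x₀ ∧ (∀ x, (ξ x).1 = K.g (γ x)) ∧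
      ξ x₀ = ⟨K.g (γ x₀), ξ₀⟩ ∧
      ∀ x ∈ s, (⟨K.f (γ x), K.A (γ x) (Om.fibAt (K.g (γ x)) (ξ x))⟩ : B.Tot) = b x := by
  classical
  let y₀ := γ x₀
  have hm : y₀ ∈ K.nhd y₀ := ⟨K.mem_base y₀, K.T_invertible y₀⟩
  -- The completed map `T` is invertible near `y₀`, so a lift is determined by the coordinates of
  -- `b` and by a free complementary coordinate. The latter is frozen at its value on `ξ₀`, which
  -- makes the lift pass through `ξ₀`.
  let c : N → B.F × K.model := fun x =>
    ((trivializationAt B.F B.fib (K.f y₀) (b x)).2, K.compl y₀ (φ (K.nhd_base hm) ξ₀))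
  let w : N → Om.F := fun x => (K.T y₀ (γ x)).inverse (c x)
  let ξ : N → Om.Tot := fun x => Om.constSec (K.g y₀) (w x) (K.g (γ x))
  have hb1 : (b x₀).1 = K.f y₀ := by rw [← h₀]
  have hc : ContMDiffWithinAt IN 𝓘(ℝ, B.F × K.model) ∞ c s x₀ := by
    have h1 := (contMDiffWithinAt_totalSpace.1 hb).2
    rw [hb1] at h1
    exact ContMDiffWithinAt.prodMk_space h1 contMDiffWithinAt_const
  have hw : ContMDiffWithinAt IN 𝓘(ℝ, Om.F) ∞ w s x₀ := by
    have h2 : ContMDiffWithinAt IN 𝓘(ℝ, B.F × K.model →L[ℝ] Om.F) ∞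
        (fun x => (K.T y₀ (γ x)).inverse) s x₀ :=
      ((K.smooth_T_inv y₀).contMDiffAt
        ((K.isOpen_nhd y₀).mem_nhds hm)).comp_contMDiffWithinAt x₀ hγ
    exact h2.clm_apply hc
  have hξ : ContMDiffWithinAt IN Om.model ∞ ξ s x₀ :=
    SmoothVB.contMDiffWithinAt_constSec (K.smooth_g.contMDiffAt.comp_contMDiffWithinAt x₀ hγ) hw hm.1.1
  have hval : ∀ x (hx : γ x ∈ K.nhd y₀), ξ x = ⟨K.g (γ x), (φ (K.nhd_base hx)).symm (w x)⟩ := by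
    intro x hx
    simp only [ξ, SmoothVB.constSec]
    congr 1
  have hξ₀ : ξ x₀ = ⟨K.g y₀, ξ₀⟩ := by
    rw [hval x₀ hm]
    congr 1
    rw [ContinuousLinearEquiv.symm_apply_eq]
    have h3 : c x₀ = K.T y₀ y₀ (φ (K.nhd_base hm) ξ₀) := by
      refine Prod.ext ?_ rfl
      change _ = K.coordA y₀ y₀ (φ (K.nhd_base hm) ξ₀)
      rw [K.coordA_apply]
      simp only [c]
      rw [← h₀]
      rfl
    simp only [w]
    rw [h3]
    exact K.inv_T hm _
  have hlift : ∀ x ∈ s, γ x ∈ K.nhd y₀ →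
      (⟨K.f (γ x), K.A (γ x) (Om.fibAt (K.g (γ x)) (ξ x))⟩ : B.Tot) = b x := by
    intro x hxs hx
    obtain ⟨b', hb'⟩ := B.exists_mk (hs x hxs)
    rw [hval x hx, hb', SmoothVB.fibAt_mk, SmoothVB.mk_inj]
    apply (ψ (K.nhd_base hx)).injective
    rw [← K.coordA_apply, ContinuousLinearEquiv.apply_symm_apply]
    have h4 := congrArg Prod.fst (K.T_inv hx (c x))
    change K.coordA y₀ (γ x) (w x) = _ at h4
    rw [h4]
    simp only [c]
    rw [hb']
    rfl
  -- The lifting identity is claimed on all of `s`, not only near `x₀`; away from the neighbourhood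
  -- an arbitrary preimage is used.
  choose r hr using fun x => K.surj (γ x)
  let ξ' : N → Om.Tot := fun x => if γ x ∈ K.nhd y₀ then ξ x else
    ⟨K.g (γ x), r x (B.fibAt (K.f (γ x)) (b x))⟩
  refine ⟨ξ', ?_, ?_, ?_, ?_⟩
  · refine hξ.congr_of_eventuallyEq ?_ (if_pos hm)
    filter_upwards [hγ.continuousWithinAt ((K.isOpen_nhd y₀).mem_nhds hm)] with x hx
    exact if_pos hx
  · intro x
    simp only [ξ']
    split_ifs <;> rfl
  · simp only [ξ']
    rw [if_pos hm, hξ₀]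
  · intro x hxs
    simp only [ξ']
    split_ifs with h
    · exact hlift x hxs h
    · rw [SmoothVB.fibAt_mk, hr, SmoothVB.mk_fibAt _ (hs x hxs)]

/-- A fibrewise surjective morphism of vector bundles, as a family over its base. -/
def ofMorphism {s : N₁ → N₂} (hs : ContMDiff I₁ I₂ ∞ s) (A : ∀ y, Om.fib y →L[ℝ] B.fib (s y))
    (hA : ContMDiff Om.model B.model ∞ (fun v : Om.Tot => (⟨s v.1, A v.1 v.2⟩ : B.Tot)))
    (hsurj : ∀ y, Function.Surjective (A y)) : SurjFamily I₁ N₁ Om B where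
  g := fun y => y
  f := s
  A := A
  smooth_g := contMDiff_id
  smooth_f := hs
  surj := hsurj
  smooth_A := smooth_coord Om B A hA contMDiff_id

/-- A fibrewise surjective morphism of vector bundles `Om → B` over `s` induces a submersion from
`Om` to the fibre product of `B` and the base of `Om`. -/
lemma exists_tangent {s : N₁ → N₂} (hs : ContMDiff I₁ I₂ ∞ s)
    (A : ∀ y, Om.fib y →L[ℝ] B.fib (s y))
    (hA : ContMDiff Om.model B.model ∞ (fun v : Om.Tot => (⟨s v.1, A v.1 v.2⟩ : B.Tot)))
    (hsurj : ∀ y, Function.Surjective (A y)) (ξ : Om.Tot)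
    (v : TangentSpace B.model (⟨s ξ.1, A ξ.1 ξ.2⟩ : B.Tot)) (w : TangentSpace I₁ ξ.1)
    (h : (mfderiv B.model I₂ (TotalSpace.proj : B.Tot → N₂) ⟨s ξ.1, A ξ.1 ξ.2⟩ v : E₂) =
      mfderiv I₁ I₂ s ξ.1 w) :
    ∃ u : TangentSpace Om.model ξ,
      mfderiv Om.model B.model (fun v : Om.Tot => (⟨s v.1, A v.1 v.2⟩ : B.Tot)) ξ u = v ∧
      mfderiv Om.model I₁ (TotalSpace.proj : Om.Tot → N₁) ξ u = w := by
  let b₀ : B.Tot := ⟨s ξ.1, A ξ.1 ξ.2⟩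
  let x₀ : B.Tot × N₁ := (b₀, ξ.1)
  have hm := FiberBundle.mem_baseSet_trivializationAt' (F := B.F) (E := B.fib) b₀.1
  let q : B.Tot → B.F := fun b => (trivializationAt B.F B.fib b₀.1 b).2
  have hq : ContMDiffAt B.model 𝓘(ℝ, B.F) ∞ q b₀ :=
    (contMDiffAt_totalSpace.1 (contMDiffAt_id (x := b₀))).2
  have hp : ContMDiffAt B.model I₂ ∞ (TotalSpace.proj : B.Tot → N₂) b₀ := contMDiffAt_proj B.fib
  let ρ : B.Tot × N₁ → N₂ × B.F := fun x => (s x.2, q x.1)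
  let e : B.Tot → N₂ × B.F := fun b => (b.1, q b)
  -- The map `e' ∘ ρ` moves `b` into the fibre over `s y`, keeping its coordinate. It is defined on
  -- the whole product `B × N₁` and near the given point is the first projection on the fibre
  -- product, so the fibre product never has to be treated as a manifold.
  let e' : N₂ × B.F → B.Tot := fun y => B.constSec b₀.1 y.2 y.1
  have hs2 : ContMDiffAt (B.model.prod I₁) I₂ ∞ (fun x : B.Tot × N₁ => s x.2) x₀ :=
    hs.contMDiffAt.comp x₀ contMDiffAt_snd
  have hq1 : ContMDiffAt (B.model.prod I₁) 𝓘(ℝ, B.F) ∞ (fun x : B.Tot × N₁ => q x.1) x₀ :=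
    ContMDiffAt.comp x₀ (g := q) hq contMDiffAt_fst
  have hρ : ContMDiffAt (B.model.prod I₁) (I₂.prod 𝓘(ℝ, B.F)) ∞ ρ x₀ := hs2.prodMk hq1
  have he : ContMDiffAt B.model (I₂.prod 𝓘(ℝ, B.F)) ∞ e b₀ := hp.prodMk hq
  have he' : ContMDiffAt (I₂.prod 𝓘(ℝ, B.F)) B.model ∞ e' (e b₀) :=
    SmoothVB.contMDiffWithinAt_constSec (s := Set.univ) contMDiffAt_fst contMDiffAt_snd hm
  have hτ : ContMDiffAt (B.model.prod I₁) B.model ∞ (e' ∘ ρ) x₀ := ContMDiffAt.comp x₀ he' hρ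
  have hee : ∀ b : B.Tot, b.1 ∈ (trivializationAt B.F B.fib b₀.1).baseSet → e' (e b) = b := by
    intro b hb
    obtain ⟨x, b⟩ := b
    simp only [e', e, SmoothVB.constSec, q]
    congr 1
    exact Trivialization.symm_proj_apply _ ⟨x, b⟩ hb
  have hevent : e' ∘ e =ᶠ[𝓝 b₀] id := by
    filter_upwards [hp.continuousAt
      ((trivializationAt B.F B.fib b₀.1).open_baseSet.mem_nhds hm)] with b hb
    exact hee b hb
  have hne : (∞ : WithTop ℕ∞) ≠ 0 := by simp
  have hdτ : mfderiv (B.model.prod I₁) B.model (e' ∘ ρ) x₀ (v, w) = v := by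
    have h1 : mfderiv (B.model.prod I₁) B.model (e' ∘ ρ) x₀ =
        (mfderiv (I₂.prod 𝓘(ℝ, B.F)) B.model e' (e b₀)).comp
          (mfderiv (B.model.prod I₁) (I₂.prod 𝓘(ℝ, B.F)) ρ x₀) :=
      mfderiv_comp x₀ (he'.mdifferentiableAt hne) (hρ.mdifferentiableAt hne)
    have h2 : mfderiv B.model B.model (e' ∘ e) b₀ =
        (mfderiv (I₂.prod 𝓘(ℝ, B.F)) B.model e' (e b₀)).comp
          (mfderiv B.model (I₂.prod 𝓘(ℝ, B.F)) e b₀) :=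
      mfderiv_comp b₀ (he'.mdifferentiableAt hne) (he.mdifferentiableAt hne)
    -- Only here does the compatibility of `v` and `w` enter: it identifies the two base components.
    have h3 : mfderiv (B.model.prod I₁) (I₂.prod 𝓘(ℝ, B.F)) ρ x₀ (v, w) =
        mfderiv B.model (I₂.prod 𝓘(ℝ, B.F)) e b₀ v := by
      have a1 : mfderiv (B.model.prod I₁) (I₂.prod 𝓘(ℝ, B.F)) ρ x₀ =
          (mfderiv (B.model.prod I₁) I₂ (fun x : B.Tot × N₁ => s x.2) x₀).prod
          (mfderiv (B.model.prod I₁) 𝓘(ℝ, B.F) (fun x : B.Tot × N₁ => q x.1) x₀) :=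
        mfderiv_prodMk (hs2.mdifferentiableAt hne) (hq1.mdifferentiableAt hne)
      have a2 : mfderiv B.model (I₂.prod 𝓘(ℝ, B.F)) e b₀ =
          (mfderiv B.model I₂ (TotalSpace.proj : B.Tot → N₂) b₀).prod
          (mfderiv B.model 𝓘(ℝ, B.F) q b₀) :=
        mfderiv_prodMk (hp.mdifferentiableAt hne) (hq.mdifferentiableAt hne)
      have a3 : mfderiv (B.model.prod I₁) I₂ (fun x : B.Tot × N₁ => s x.2) x₀ =
          (mfderiv I₁ I₂ s ξ.1).comp (mfderiv (B.model.prod I₁) I₁ Prod.snd x₀) :=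
        mfderiv_comp x₀ (hs.contMDiffAt.mdifferentiableAt hne) mdifferentiableAt_snd
      have a4 : mfderiv (B.model.prod I₁) 𝓘(ℝ, B.F) (fun x : B.Tot × N₁ => q x.1) x₀ =
          (mfderiv B.model 𝓘(ℝ, B.F) q b₀).comp (mfderiv (B.model.prod I₁) B.model Prod.fst x₀) :=
        mfderiv_comp x₀ (hq.mdifferentiableAt hne) mdifferentiableAt_fst
      rw [a1, a2, a3, a4, mfderiv_snd, mfderiv_fst]
      exact Prod.ext h.symm rfl
    rw [h1]
    change mfderiv (I₂.prod 𝓘(ℝ, B.F)) B.model e' (e b₀)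
      (mfderiv (B.model.prod I₁) (I₂.prod 𝓘(ℝ, B.F)) ρ x₀ (v, w)) = v
    rw [h3]
    have h4 := congrArg (fun l => l v) (h2.symm.trans (hevent.mfderiv_eq.trans mfderiv_id))
    exact h4
  -- A local lift `σ` of `e' ∘ ρ` through the given vector `ξ`; the derivative of `σ` at `(v, w)` is
  -- the required tangent vector.
  obtain ⟨σ, hσ, hσ1, hσ0, hσA⟩ := (ofMorphism hs A hA hsurj).exists_lift (IN := B.model.prod I₁)
    (γ := Prod.snd) (b := e' ∘ ρ) (s := Set.univ) (x₀ := x₀) contMDiffAt_snd hτ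
    (fun x _ => rfl) ξ.2 (hee b₀ hm).symm
  have hσ' : ContMDiffAt (B.model.prod I₁) Om.model ∞ σ x₀ := hσ
  have hσ0' : σ x₀ = ξ := hσ0
  have hpσ : (TotalSpace.proj : Om.Tot → N₁) ∘ σ = Prod.snd := funext hσ1
  have hAσ : (fun v : Om.Tot => (⟨s v.1, A v.1 v.2⟩ : B.Tot)) ∘ σ = e' ∘ ρ := by
    funext x
    have h5 := hσA x trivial
    change (⟨s x.2, A x.2 (Om.fibAt x.2 (σ x))⟩ : B.Tot) = _ at h5
    rw [← h5]
    obtain ⟨a, ha⟩ : ∃ a : Om.fib x.2, σ x = ⟨x.2, a⟩ := Om.exists_mk (hσ1 x)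
    rw [Function.comp_apply, ha, SmoothVB.fibAt_mk]
  have hOm : ContMDiffAt Om.model I₁ ∞ (TotalSpace.proj : Om.Tot → N₁) (σ x₀) :=
    contMDiffAt_proj Om.fib
  have d1 := mfderiv_comp x₀ (hA.contMDiffAt.mdifferentiableAt hne) (hσ'.mdifferentiableAt hne)
  have d2 := mfderiv_comp x₀ (hOm.mdifferentiableAt hne) (hσ'.mdifferentiableAt hne)
  rw [hAσ] at d1
  rw [hpσ, mfderiv_snd] at d2
  rw [hσ0'] at d1 d2
  refine ⟨mfderiv (B.model.prod I₁) Om.model σ x₀ (v, w), ?_, ?_⟩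
  · rw [d1] at hdτ
    exact hdτ
  · exact (congrArg (fun l => l (v, w)) d2).symm

end SurjFamily
end KernelBundle

/-! ### Arithmetic of vectors in a common fibre. -/

namespace SmoothVB

variable {E H : Type*} [NormedAddCommGroup E] [NormedSpace ℝ E] [TopologicalSpace H]
  {I : ModelWithCorners ℝ E H} {M : Type*} [TopologicalSpace M] [ChartedSpace H M]
  {V : SmoothVB I M}

lemma fibAt_tadd {x : M} {ξ η : V.Tot} (h : ξ.1 = x) (h' : η.1 = x) :
    V.fibAt x (V.tadd ξ η) = V.fibAt x ξ + V.fibAt x η := by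
  obtain ⟨v, rfl⟩ := V.exists_mk h
  obtain ⟨w, rfl⟩ := V.exists_mk h'
  simp

lemma fibAt_tsmul {x : M} (c : ℝ) {ξ : V.Tot} (h : ξ.1 = x) :
    V.fibAt x (V.tsmul c ξ) = c • V.fibAt x ξ := by
  obtain ⟨v, rfl⟩ := V.exists_mk h
  simp

lemma ev_tadd {Φ : V.dual.Tot} {ξ η : V.Tot} (h : ξ.1 = Φ.1) (h' : η.1 = Φ.1) :
    V.ev Φ (V.tadd ξ η) = V.ev Φ ξ + V.ev Φ η := by
  simp only [ev]
  rw [fibAt_tadd h h', pair_add]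

@[simp] lemma ev_zero (Φ : V.dual.Tot) (x : M) : V.ev Φ (V.zero x) = 0 := by
  obtain ⟨y, Φ⟩ := Φ
  by_cases h : x = y
  · subst h
    simp [zero, pair_zero]
  · have h1 : V.fibAt y (V.zero x) = 0 := dif_neg h
    simp only [ev, h1, pair_zero]

lemma tadd_zero {x : M} {ξ : V.Tot} (h : ξ.1 = x) : V.tadd ξ (V.zero x) = ξ := by
  obtain ⟨v, rfl⟩ := V.exists_mk h
  simp [zero]

lemma tsmul_zero (c : ℝ) (x : M) : V.tsmul c (V.zero x) = V.zero x := by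
  simp [zero]

lemma zero_tadd {x : M} {ξ : V.Tot} (h : ξ.1 = x) : V.tadd (V.zero x) ξ = ξ := by
  obtain ⟨v, rfl⟩ := V.exists_mk h
  simp [zero]

lemma tadd_tsub {ξ η : V.Tot} (h : η.1 = ξ.1) : V.tadd η (V.tsub ξ η) = ξ := by
  obtain ⟨x, v⟩ := ξ
  obtain ⟨w, rfl⟩ := V.exists_mk (x := x) h
  simp

end SmoothVB

/-! ### Algebraic identities in a groupoid. -/

namespace GroupoidData.IsLieGroupoid

variable {EG HG EP HP : Type*}
  [NormedAddCommGroup EG] [NormedSpace ℝ EG] [TopologicalSpace HG]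
  [NormedAddCommGroup EP] [NormedSpace ℝ EP] [TopologicalSpace HP]
  {I : ModelWithCorners ℝ EG HG} {J : ModelWithCorners ℝ EP HP}
  {G P : Type*} [TopologicalSpace G] [ChartedSpace HG G] [TopologicalSpace P] [ChartedSpace HP P]
  {T : GroupoidData G P}
-- Uniqueness of inverses. It replaces axioms that are not assumed: linearity of inversion in a
-- VB-groupoid and preservation of inverses by morphisms.
lemma eq_inv_of_mul (hT : T.IsLieGroupoid I J) {g h : G} (hc : T.src g = T.tgt h) (hm : T.mul g h = T.one (T.tgt g)) :
    h = T.inv g := by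
  calc h = T.mul (T.one (T.tgt h)) h := (hT.one_mul h).symm
    _ = T.mul (T.mul (T.inv g) g) h := by rw [hT.inv_mul, hc]
    _ = T.mul (T.inv g) (T.mul g h) := hT.mul_assoc _ _ _ (hT.src_inv g) hc
    _ = T.mul (T.inv g) (T.one (T.src (T.inv g))) := by rw [hm, hT.src_inv]
    _ = T.inv g := hT.mul_one _

lemma inv_inv (hT : T.IsLieGroupoid I J) (g : G) : T.inv (T.inv g) = g :=
  (hT.eq_inv_of_mul (hT.src_inv g) (by rw [hT.inv_mul, hT.tgt_inv])).symm

lemma mul_inv_mul (hT : T.IsLieGroupoid I J) {g h : G} (hc : T.src g = T.src h) : T.mul (T.mul g (T.inv h)) h = g := by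
  rw [hT.mul_assoc _ _ _ (hc.trans (hT.tgt_inv h).symm) (hT.src_inv h), hT.inv_mul, ← hc,
    hT.mul_one]

lemma mul_mul_inv (hT : T.IsLieGroupoid I J) {g h : G} (hc : T.src g = T.tgt h) : T.mul (T.mul g h) (T.inv h) = g := by
  rw [hT.mul_assoc _ _ _ hc (hT.tgt_inv h).symm, hT.mul_inv, ← hc, hT.mul_one]

lemma mul_inv_rev (hT : T.IsLieGroupoid I J) {g h : G} (hc : T.src g = T.tgt h) :
    T.inv (T.mul g h) = T.mul (T.inv h) (T.inv g) := by
  have h1 : T.src (T.inv h) = T.tgt (T.inv g) := by rw [hT.src_inv, hT.tgt_inv, hc]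
  refine (hT.eq_inv_of_mul ?_ ?_).symm
  · rw [hT.src_mul _ _ hc, hT.tgt_mul _ _ h1, hT.tgt_inv]
  · rw [← hT.mul_assoc _ _ _ ((hT.src_mul _ _ hc).trans (hT.tgt_inv h).symm) h1,
      hT.mul_mul_inv hc, hT.mul_inv, hT.tgt_mul _ _ hc]

lemma inv_one (hT : T.IsLieGroupoid I J) (p : P) : T.inv (T.one p) = T.one p := by
  refine (hT.eq_inv_of_mul ?_ ?_).symm
  · rw [hT.src_one, hT.tgt_one]
  · have := hT.mul_one (T.one p)
    rw [hT.src_one] at this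
    rw [this, hT.tgt_one]

end GroupoidData.IsLieGroupoid

/-! ### Linearity of the structure maps, core elements and their translates, and factorizations. -/

namespace VBGroupoid

variable {EG HG EP HP : Type*}
  [NormedAddCommGroup EG] [NormedSpace ℝ EG] [TopologicalSpace HG]
  [NormedAddCommGroup EP] [NormedSpace ℝ EP] [TopologicalSpace HP]
  {I : ModelWithCorners ℝ EG HG} {J : ModelWithCorners ℝ EP HP}
  {G P : Type*} [TopologicalSpace G] [ChartedSpace HG G] [TopologicalSpace P] [ChartedSpace HP P]
  {S : LieGroupoid I J G P} {Om : SmoothVB I G} {B : SmoothVB J P} (V : VBGroupoid S Om B)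

lemma src_zero (γ : G) : V.total.src (Om.zero γ) = B.zero (S.src γ) := by
  simp only [VBGroupoidData.total, SmoothVB.zero, map_zero]

lemma tgt_zero (γ : G) : V.total.tgt (Om.zero γ) = B.zero (S.tgt γ) := by
  simp only [VBGroupoidData.total, SmoothVB.zero, map_zero]

lemma one_zero (p : P) : V.total.one (B.zero p) = Om.zero (S.one p) := by
  simp only [VBGroupoidData.total, SmoothVB.zero, map_zero]

section linear
variable {ξ η ξ' η' : Om.Tot}

lemma src_tadd (h : ξ.1 = η.1) :
    V.total.src (Om.tadd ξ η) = B.tadd (V.total.src ξ) (V.total.src η) := by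
  obtain ⟨γ, ξ⟩ := ξ
  obtain ⟨η, rfl⟩ := Om.exists_mk (x := γ) h.symm
  simp [VBGroupoidData.total]

lemma tgt_tadd (h : ξ.1 = η.1) :
    V.total.tgt (Om.tadd ξ η) = B.tadd (V.total.tgt ξ) (V.total.tgt η) := by
  obtain ⟨γ, ξ⟩ := ξ
  obtain ⟨η, rfl⟩ := Om.exists_mk (x := γ) h.symm
  simp [VBGroupoidData.total]

lemma src_tsub (h : ξ.1 = η.1) :
    V.total.src (Om.tsub ξ η) = B.tsub (V.total.src ξ) (V.total.src η) := by
  obtain ⟨γ, ξ⟩ := ξ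
  obtain ⟨η, rfl⟩ := Om.exists_mk (x := γ) h.symm
  simp [VBGroupoidData.total]

lemma src_tsmul (c : ℝ) (ξ : Om.Tot) :
    V.total.src (Om.tsmul c ξ) = B.tsmul c (V.total.src ξ) := by
  simp only [VBGroupoidData.total, SmoothVB.tsmul, map_smul]
  rfl

lemma tgt_tsmul (c : ℝ) (ξ : Om.Tot) :
    V.total.tgt (Om.tsmul c ξ) = B.tsmul c (V.total.tgt ξ) := by
  simp only [VBGroupoidData.total, SmoothVB.tsmul, map_smul]
  rfl

lemma one_tadd {b b' : B.Tot} (h : b.1 = b'.1) :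
    V.total.one (B.tadd b b') = Om.tadd (V.total.one b) (V.total.one b') := by
  obtain ⟨p, b⟩ := b
  obtain ⟨b', rfl⟩ := B.exists_mk (x := p) h.symm
  simp [VBGroupoidData.total]

lemma one_tsmul (c : ℝ) (b : B.Tot) :
    V.total.one (B.tsmul c b) = Om.tsmul c (V.total.one b) := by
  simp only [VBGroupoidData.total, SmoothVB.tsmul, map_smul]
  rfl

lemma mul_tadd (h : ξ.1 = ξ'.1) (h' : η.1 = η'.1) (hc : V.total.src ξ = V.total.tgt η)
    (hc' : V.total.src ξ' = V.total.tgt η') :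
    V.total.mul (Om.tadd ξ ξ') (Om.tadd η η') =
      Om.tadd (V.total.mul ξ η) (V.total.mul ξ' η') := by
  obtain ⟨γ, ξ⟩ := ξ
  obtain ⟨ξ', rfl⟩ := Om.exists_mk (x := γ) h.symm
  obtain ⟨δ, η⟩ := η
  obtain ⟨η', rfl⟩ := Om.exists_mk (x := δ) h'.symm
  simp only [VBGroupoidData.total, SmoothVB.tadd_mk]
  rw [V.mul_add _ _ _ _ _ _ hc hc']

lemma mul_tsmul (c : ℝ) (hc : V.total.src ξ = V.total.tgt η) :
    V.total.mul (Om.tsmul c ξ) (Om.tsmul c η) = Om.tsmul c (V.total.mul ξ η) := by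
  simp only [VBGroupoidData.total, SmoothVB.tsmul]
  rw [V.mul_smul _ _ _ _ _ hc]
  rfl

/-- Homogeneity of the product with factor 0. -/
lemma mul_zero {γ δ : G} (h : S.src γ = S.tgt δ) :
    V.total.mul (Om.zero γ) (Om.zero δ) = Om.zero (S.mul γ δ) := by
  have hc : V.total.src (Om.zero γ) = V.total.tgt (Om.zero δ) := by
    rw [V.src_zero, V.tgt_zero, h]
  have h1 := V.mul_smul γ δ 0 0 0 hc
  rw [smul_zero, smul_zero, zero_smul] at h1
  simp only [VBGroupoidData.total, SmoothVB.zero]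
  rw [h1]

lemma inv_zero (γ : G) : V.total.inv (Om.zero γ) = Om.zero (S.inv γ) := by
  have h := S.isLieGroupoid
  refine (V.isLieGroupoid.eq_inv_of_mul ?_ ?_).symm
  · rw [V.src_zero, V.tgt_zero, h.tgt_inv]
  · rw [V.mul_zero (h.tgt_inv γ).symm, V.tgt_zero, V.one_zero, h.mul_inv]

/-- By additivity of the product, `ξ⁻¹ + η⁻¹` is inverse to `ξ + η`, and inverses are unique. -/
lemma inv_tadd (h : ξ.1 = η.1) :
    V.total.inv (Om.tadd ξ η) = Om.tadd (V.total.inv ξ) (V.total.inv η) := by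
  have hT := V.isLieGroupoid
  have h' : (V.total.inv ξ).1 = (V.total.inv η).1 := congrArg S.inv h
  refine (hT.eq_inv_of_mul ?_ ?_).symm
  · rw [V.src_tadd h, V.tgt_tadd h', hT.tgt_inv, hT.tgt_inv]
  · rw [V.mul_tadd h h' (hT.tgt_inv ξ).symm (hT.tgt_inv η).symm, V.tgt_tadd h, V.one_tadd,
      hT.mul_inv, hT.mul_inv]
    exact congrArg S.tgt h

lemma inv_tsmul (c : ℝ) (ξ : Om.Tot) :
    V.total.inv (Om.tsmul c ξ) = Om.tsmul c (V.total.inv ξ) := by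
  have hT := V.isLieGroupoid
  refine (hT.eq_inv_of_mul ?_ ?_).symm
  · rw [V.src_tsmul, V.tgt_tsmul, hT.tgt_inv]
  · rw [V.mul_tsmul c (hT.tgt_inv ξ).symm, V.tgt_tsmul, V.one_tsmul, hT.mul_inv]

end linear

/-- The inclusion of the core on total spaces. -/
def inc (κ : V.core.Tot) : Om.Tot := ⟨S.one κ.1, V.coreIncl κ.1 κ.2⟩

lemma src_inc (κ : V.core.Tot) : V.total.src (V.inc κ) = B.zero κ.1 := by
  have h : V.total.src (V.inc κ) = B.zero (S.src (S.one κ.1)) := by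
    simp only [VBGroupoidData.total, inc, V.src_coreIncl, SmoothVB.zero]
  rw [h, S.isLieGroupoid.src_one]

lemma inc_tadd {κ κ' : V.core.Tot} (h : κ.1 = κ'.1) :
    V.inc (V.core.tadd κ κ') = Om.tadd (V.inc κ) (V.inc κ') := by
  obtain ⟨p, κ⟩ := κ
  obtain ⟨κ', rfl⟩ := V.core.exists_mk (x := p) h.symm
  rw [SmoothVB.tadd_mk]
  simp only [inc, map_add, SmoothVB.tadd_mk]

lemma inc_tsmul (c : ℝ) (κ : V.core.Tot) : V.inc (V.core.tsmul c κ) = Om.tsmul c (V.inc κ) := by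
  simp only [inc, SmoothVB.tsmul]
  rfl

lemma inc_injective {κ κ' : V.core.Tot} (h₁ : κ.1 = κ'.1) (h : V.inc κ = V.inc κ') : κ = κ' := by
  obtain ⟨p, κ⟩ := κ
  obtain ⟨κ', rfl⟩ := V.core.exists_mk (x := p) h₁.symm
  congr 1
  exact Subtype.ext (Om.mk_inj.1 h)

lemma exists_inc {ξ : Om.Tot} {p : P} (h : ξ.1 = S.one p) (hs : V.total.src ξ = B.zero p) :
    ∃ κ : V.core.Tot, κ.1 = p ∧ V.inc κ = ξ := by
  obtain ⟨v, rfl⟩ := Om.exists_mk h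
  have h1 : V.src (S.one p) v = 0 := by
    have h2 : (⟨S.src (S.one p), V.src (S.one p) v⟩ : B.Tot) = B.zero (S.src (S.one p)) :=
      hs.trans (congrArg B.zero (S.isLieGroupoid.src_one p).symm)
    exact B.mk_inj.1 h2
  exact ⟨⟨p, (⟨v, h1⟩ : V.coreFamily.fib p)⟩, rfl, rfl⟩

lemma src_inc_eq (κ : V.core.Tot) {γ : G} (h : κ.1 = S.tgt γ) :
    V.total.src (V.inc κ) = V.total.tgt (Om.zero γ) := by
  rw [V.src_inc, V.tgt_zero, h]

lemma tgt_inv_inc_eq (κ : V.core.Tot) {γ : G} (h : κ.1 = S.src γ) :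
    V.total.src (Om.zero γ) = V.total.tgt (V.total.inv (V.inc κ)) := by
  rw [V.isLieGroupoid.tgt_inv, V.src_inc, V.src_zero, h]

/-- The right translate `k 0_γ` of a core element. -/
def rtr (γ : G) (κ : V.core.Tot) : Om.Tot := V.total.mul (V.inc κ) (Om.zero γ)

/-- The left translate `0_γ k⁻¹` of the inverse of a core element. -/
def ltr (γ : G) (κ : V.core.Tot) : Om.Tot := V.total.mul (Om.zero γ) (V.total.inv (V.inc κ))

section translations
variable {γ : G} {κ κ' : V.core.Tot}

lemma rtr_fst (h : κ.1 = S.tgt γ) : (V.rtr γ κ).1 = γ := by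
  change S.mul (S.one κ.1) γ = γ
  rw [h, S.isLieGroupoid.one_mul]

lemma ltr_fst (h : κ.1 = S.src γ) : (V.ltr γ κ).1 = γ := by
  change S.mul γ (S.inv (S.one κ.1)) = γ
  rw [h, S.isLieGroupoid.inv_one, S.isLieGroupoid.mul_one]

/-- The product is only jointly additive; writing the fixed factor as `0 = 0 + 0` gives additivity
in the core element alone. -/
lemma rtr_tadd (h : κ.1 = S.tgt γ) (h' : κ'.1 = S.tgt γ) :
    V.rtr γ (V.core.tadd κ κ') = Om.tadd (V.rtr γ κ) (V.rtr γ κ') := by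
  have h1 := V.mul_tadd (ξ := V.inc κ) (ξ' := V.inc κ') (η := Om.zero γ) (η' := Om.zero γ)
    (congrArg S.one (h.trans h'.symm)) rfl (V.src_inc_eq κ h) (V.src_inc_eq κ' h')
  rw [SmoothVB.tadd_zero (x := γ) (ξ := Om.zero γ) rfl, ← V.inc_tadd (h.trans h'.symm)] at h1
  exact h1

lemma rtr_tsmul (c : ℝ) (h : κ.1 = S.tgt γ) :
    V.rtr γ (V.core.tsmul c κ) = Om.tsmul c (V.rtr γ κ) := by
  have h1 := V.mul_tsmul c (V.src_inc_eq κ h)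
  rw [← V.inc_tsmul, SmoothVB.tsmul_zero] at h1
  exact h1

lemma ltr_tadd (h : κ.1 = S.src γ) (h' : κ'.1 = S.src γ) :
    V.ltr γ (V.core.tadd κ κ') = Om.tadd (V.ltr γ κ) (V.ltr γ κ') := by
  have h2 : (V.inc κ).1 = (V.inc κ').1 := congrArg S.one (h.trans h'.symm)
  have h1 := V.mul_tadd (ξ := Om.zero γ) (ξ' := Om.zero γ) (η := V.total.inv (V.inc κ))
    (η' := V.total.inv (V.inc κ')) rfl
    (congrArg S.inv h2) (V.tgt_inv_inc_eq κ h) (V.tgt_inv_inc_eq κ' h')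
  rw [SmoothVB.tadd_zero (x := γ) (ξ := Om.zero γ) rfl, ← V.inv_tadd h2, ← V.inc_tadd (h.trans h'.symm)] at h1
  exact h1

lemma ltr_tsmul (c : ℝ) (h : κ.1 = S.src γ) :
    V.ltr γ (V.core.tsmul c κ) = Om.tsmul c (V.ltr γ κ) := by
  have h1 := V.mul_tsmul c (V.tgt_inv_inc_eq κ h)
  rw [← V.inv_tsmul, ← V.inc_tsmul, SmoothVB.tsmul_zero] at h1
  exact h1

end translations

lemma exists_src_eq {γ : G} {b : B.Tot} (h : b.1 = S.src γ) :
    ∃ ξ : Om.Tot, ξ.1 = γ ∧ V.total.src ξ = b := by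
  obtain ⟨ξ, h1, h2⟩ := V.src_proj_surjective b γ h
  exact ⟨ξ, h2, h1⟩

/-- Choose `ξ` over `γ` with the source of `θ` and set `η = θ ξ⁻¹`. Hence covectors over `δγ` are
determined by their values on products. -/
lemma exists_mul_eq {δ γ : G} (h : S.src δ = S.tgt γ) {θ : Om.Tot} (hθ : θ.1 = S.mul δ γ) :
    ∃ η ξ : Om.Tot, η.1 = δ ∧ ξ.1 = γ ∧ V.total.src η = V.total.tgt ξ ∧ V.total.mul η ξ = θ := by
  have hT := V.isLieGroupoid
  obtain ⟨ξ, hξ, hs⟩ := V.exists_src_eq (γ := γ) (b := V.total.src θ)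
    ((congrArg S.src hθ).trans (S.isLieGroupoid.src_mul _ _ h))
  have hc : V.total.src θ = V.total.tgt (V.total.inv ξ) := by rw [hT.tgt_inv, hs]
  refine ⟨V.total.mul θ (V.total.inv ξ), ξ, ?_, hξ, ?_, hT.mul_inv_mul hs.symm⟩
  · change S.mul θ.1 (S.inv ξ.1) = δ
    rw [hθ, hξ, S.isLieGroupoid.mul_mul_inv h]
  · rw [hT.src_mul _ _ hc, hT.src_inv]

/-- Factorizations of zero come from core elements. -/
lemma exists_of_mul_eq_zero {η ξ : Om.Tot} (hc : V.total.src η = V.total.tgt ξ)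
    (h : V.total.mul η ξ = Om.zero (S.mul η.1 ξ.1)) :
    ∃ κ : V.core.Tot, κ.1 = S.tgt ξ.1 ∧ ξ = V.rtr ξ.1 κ ∧ η = V.ltr η.1 κ := by
  have hT := V.isLieGroupoid
  have hS := S.isLieGroupoid
  have hc' : S.src η.1 = S.tgt ξ.1 := congrArg TotalSpace.proj hc
  have h1 : V.total.src ξ = V.total.src (Om.zero ξ.1) := by
    rw [← hT.src_mul _ _ hc, h, V.src_zero, V.src_zero, hS.src_mul _ _ hc']
  have h2 : V.total.src ξ = V.total.tgt (V.total.inv (Om.zero ξ.1)) := by rw [hT.tgt_inv, h1]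
  -- Since the product is zero, `ξ` has source zero, so `ξ 0⁻¹` is defined and lies in the core.
  obtain ⟨κ, hκ, hi⟩ := V.exists_inc (ξ := V.total.mul ξ (V.total.inv (Om.zero ξ.1)))
    (p := S.tgt ξ.1) (hS.mul_inv ξ.1) (by rw [hT.src_mul _ _ h2, hT.src_inv, V.tgt_zero])
  have h3 : ξ = V.rtr ξ.1 κ := by
    rw [rtr, hi, hT.mul_inv_mul h1]
  refine ⟨κ, hκ, h3, ?_⟩
  have h4 : V.total.src (V.inc κ) = V.total.tgt (Om.zero ξ.1) := V.src_inc_eq κ hκ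
  have h5 : V.total.inv ξ = V.total.mul (Om.zero (S.inv ξ.1)) (V.total.inv (V.inc κ)) := by
    conv_lhs => rw [h3, rtr, hT.mul_inv_rev h4, V.inv_zero]
  have h6 : S.src (S.mul η.1 ξ.1) = S.tgt (S.inv ξ.1) := by
    rw [hS.src_mul _ _ hc', hS.tgt_inv]
  -- The other factor is recovered as `η = (ηξ) ξ⁻¹`, a product of zeros with `k⁻¹`.
  conv_lhs => rw [← hT.mul_mul_inv hc, h, h5]
  rw [← hT.mul_assoc, V.mul_zero h6, hS.mul_mul_inv hc', ltr]
  · rw [V.src_zero, V.tgt_zero, h6]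
  · rw [V.src_zero, hS.src_inv, hT.tgt_inv, V.src_inc, hκ]

/-- An element over an identity arrow is the sum of an identity and a core element. -/
lemma exists_one_tadd_inc {ξ : Om.Tot} {p : P} (h : ξ.1 = S.one p) :
    ∃ κ : V.core.Tot, κ.1 = p ∧ ξ = Om.tadd (V.total.one (V.total.src ξ)) (V.inc κ) ∧
      V.inc κ = Om.tsub ξ (V.total.one (V.total.src ξ)) := by
  have hb : (V.total.src ξ).1 = p := (congrArg S.src h).trans (S.isLieGroupoid.src_one p)
  have h1 : (V.total.one (V.total.src ξ)).1 = ξ.1 := (congrArg S.one hb).trans h.symm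
  -- Subtracting the identity at the source of `ξ` leaves a vector with source zero.
  obtain ⟨κ, hκ, hi⟩ := V.exists_inc (ξ := Om.tsub ξ (V.total.one (V.total.src ξ)))
    (p := p) h (by
      rw [V.src_tsub h1.symm, V.isLieGroupoid.src_one]
      obtain ⟨b, hb'⟩ := B.exists_mk hb
      rw [hb']
      simp [SmoothVB.zero])
  exact ⟨κ, hκ, by rw [hi, SmoothVB.tadd_tsub h1], hi⟩

end VBGroupoid

/-! ### The structure maps of the dual and their pairing formulas. -/

namespace VBGroupoid

variable {EG HG EP HP : Type*}
  [NormedAddCommGroup EG] [NormedSpace ℝ EG] [TopologicalSpace HG]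
  [NormedAddCommGroup EP] [NormedSpace ℝ EP] [TopologicalSpace HP]
  {I : ModelWithCorners ℝ EG HG} {J : ModelWithCorners ℝ EP HP}
  {G P : Type*} [TopologicalSpace G] [ChartedSpace HG G] [TopologicalSpace P] [ChartedSpace HP P]
  {S : LieGroupoid I J G P} {Om : SmoothVB I G} {B : SmoothVB J P} (V : VBGroupoid S Om B)

/-- Right translation `k ↦ k 0_γ` of core elements. -/
def rtrCLM (γ : G) : V.core.fib (S.tgt γ) →L[ℝ] Om.fib γ :=
  SmoothVB.toCLM _ _
    { toFun := fun k => Om.fibAt γ (V.rtr γ ⟨S.tgt γ, k⟩)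
      map_add' := fun k k' => by
        rw [← SmoothVB.tadd_mk, V.rtr_tadd rfl rfl,
          SmoothVB.fibAt_tadd (V.rtr_fst rfl) (V.rtr_fst rfl)]
      map_smul' := fun c k => by
        rw [← SmoothVB.tsmul_mk, V.rtr_tsmul c rfl, SmoothVB.fibAt_tsmul c (V.rtr_fst rfl)]
        rfl }

lemma rtrCLM_apply (γ : G) (k : V.core.fib (S.tgt γ)) :
    V.rtrCLM γ k = Om.fibAt γ (V.rtr γ ⟨S.tgt γ, k⟩) := SmoothVB.toCLM_apply _ _ _ _

/-- The map `k ↦ -0_γ k⁻¹` on core elements. -/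
def negLtrCLM (γ : G) : V.core.fib (S.src γ) →L[ℝ] Om.fib γ :=
  SmoothVB.toCLM _ _
    { toFun := fun k => -Om.fibAt γ (V.ltr γ ⟨S.src γ, k⟩)
      map_add' := fun k k' => by
        rw [← SmoothVB.tadd_mk, V.ltr_tadd rfl rfl,
          SmoothVB.fibAt_tadd (V.ltr_fst rfl) (V.ltr_fst rfl), neg_add]
      map_smul' := fun c k => by
        rw [← SmoothVB.tsmul_mk, V.ltr_tsmul c rfl, SmoothVB.fibAt_tsmul c (V.ltr_fst rfl),
          ← smul_neg]
        rfl }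

lemma negLtrCLM_apply (γ : G) (k : V.core.fib (S.src γ)) :
    V.negLtrCLM γ k = -Om.fibAt γ (V.ltr γ ⟨S.src γ, k⟩) := SmoothVB.toCLM_apply _ _ _ _

/-- The identity element with the same source as a vector over an identity arrow. -/
def oneSrc (p : P) : Om.fib (S.one p) →ₗ[ℝ] Om.fib (S.one p) where
  toFun θ := Om.fibAt (S.one p) (V.total.one (V.total.src ⟨S.one p, θ⟩))
  map_add' θ θ' := by
    have h : ∀ θ : Om.fib (S.one p), (V.total.one (V.total.src ⟨S.one p, θ⟩)).1 = S.one p :=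
      fun θ => congrArg S.one (S.isLieGroupoid.src_one p)
    rw [← SmoothVB.tadd_mk, V.src_tadd (ξ := ⟨_, θ⟩) (η := ⟨_, θ'⟩) rfl, 
      V.one_tadd (b := V.total.src ⟨_, θ⟩) (b' := V.total.src ⟨_, θ'⟩) rfl,
       SmoothVB.fibAt_tadd (h _) (h _)]
  map_smul' c θ := by
    have h : (V.total.one (V.total.src ⟨S.one p, θ⟩)).1 = S.one p :=
      congrArg S.one (S.isLieGroupoid.src_one p)
    rw [← SmoothVB.tsmul_mk, V.src_tsmul, V.one_tsmul, SmoothVB.fibAt_tsmul c h]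
    rfl

/-- The projection `1_b + k ↦ k` to the core, as a linear map. -/
def corePartLin (p : P) : Om.fib (S.one p) →ₗ[ℝ] V.core.fib p :=
  show Om.fib (S.one p) →ₗ[ℝ] V.coreFamily.fib p from
    LinearMap.codRestrict (V.coreFamily.fib p) (LinearMap.id - V.oneSrc p) (fun θ => by
      obtain ⟨κ, rfl, -, h⟩ := V.exists_one_tadd_inc (ξ := ⟨S.one p, θ⟩) rfl
      have h1 : V.coreIncl κ.1 κ.2 =
          (LinearMap.id - V.oneSrc κ.1 : Om.fib (S.one κ.1) →ₗ[ℝ] Om.fib (S.one κ.1)) θ :=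
        Om.mk_inj.1 h
      have h2 := V.src_coreIncl κ.1 κ.2
      rw [h1] at h2
      exact h2)

/-- The projection `1_b + k ↦ k` to the core. -/
def corePart (p : P) : Om.fib (S.one p) →L[ℝ] V.core.fib p :=
  SmoothVB.toCLM _ _ (V.corePartLin p)

lemma inc_corePart (p : P) (θ : Om.fib (S.one p)) :
    V.inc ⟨p, V.corePart p θ⟩ =
      Om.tsub ⟨S.one p, θ⟩ (V.total.one (V.total.src ⟨S.one p, θ⟩)) := by
  have h : V.corePart p θ = V.corePartLin p θ := SmoothVB.toCLM_apply _ _ _ _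
  rw [h]
  rfl

/-- The linear form `θ ↦ -⟨Φ, θ⁻¹⟩` over the inverse arrow. -/
def dualInv (γ : G) (Φ : Om.dual.fib γ) : Om.dual.fib (S.inv γ) :=
  Om.toDual
    { toFun := fun θ => -Om.ev ⟨γ, Φ⟩ (V.total.inv ⟨S.inv γ, θ⟩)
      map_add' := fun θ θ' => by
        have h : ∀ θ : Om.fib (S.inv γ), (V.total.inv ⟨S.inv γ, θ⟩).1 = γ :=
          fun θ => S.isLieGroupoid.inv_inv γ
        rw [← SmoothVB.tadd_mk, V.inv_tadd (ξ := ⟨_, θ⟩) (η := ⟨_, θ'⟩) rfl,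
          SmoothVB.ev_tadd (h _) (h _), neg_add]
      map_smul' := fun c θ => by
        have h : (V.total.inv ⟨S.inv γ, θ⟩).1 = γ := S.isLieGroupoid.inv_inv γ
        rw [← SmoothVB.tsmul_mk, V.inv_tsmul]
        simp only [SmoothVB.ev]
        rw [SmoothVB.fibAt_tsmul c h, SmoothVB.pair_smul]
        simp }

/-- The defining property of the product of two covectors. -/
def IsDualMul {δ γ : G} (Ψ : Om.dual.fib δ) (Φ : Om.dual.fib γ) (Θ : Om.dual.fib (S.mul δ γ)) :
    Prop :=
  ∀ (η : Om.fib δ) (ξ : Om.fib γ), V.total.src ⟨δ, η⟩ = V.total.tgt ⟨γ, ξ⟩ →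
    Om.pair Θ (V.mul δ γ η ξ) = Om.pair Ψ η + Om.pair Φ ξ

open Classical in
/-- The structure maps of the dual VB-groupoid. -/
def dualData : VBGroupoidData S Om.dual V.core.dual where
  src γ := ContinuousLinearMap.precomp ℝ (V.negLtrCLM γ)
  tgt γ := ContinuousLinearMap.precomp ℝ (V.rtrCLM γ)
  one p := ContinuousLinearMap.precomp ℝ (V.corePart p)
  inv γ Φ := V.dualInv γ Φ
  mul _ _ Ψ Φ := if h : ∃ Θ, V.IsDualMul Ψ Φ Θ then h.choose else 0

section ev

lemma core_ev_tgt (Φ : Om.dual.Tot) (κ : V.core.Tot) (h : κ.1 = S.tgt Φ.1) :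
    V.core.ev (V.dualData.total.tgt Φ) κ = Om.ev Φ (V.rtr Φ.1 κ) := by
  obtain ⟨k, rfl⟩ := V.core.exists_mk h
  have h1 : V.core.ev (V.dualData.total.tgt Φ) ⟨S.tgt Φ.1, k⟩ =
      V.core.pair (V.dualData.tgt Φ.1 Φ.2) k := SmoothVB.ev_mk _ _ _
  rw [h1]
  change Om.pair Φ.2 (V.rtrCLM Φ.1 k) = _
  rw [rtrCLM_apply]
  rfl

lemma core_ev_src (Φ : Om.dual.Tot) (κ : V.core.Tot) (h : κ.1 = S.src Φ.1) :
    V.core.ev (V.dualData.total.src Φ) κ = -Om.ev Φ (V.ltr Φ.1 κ) := by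
  obtain ⟨k, rfl⟩ := V.core.exists_mk h
  have h1 : V.core.ev (V.dualData.total.src Φ) ⟨S.src Φ.1, k⟩ =
      V.core.pair (V.dualData.src Φ.1 Φ.2) k := SmoothVB.ev_mk _ _ _
  rw [h1]
  change Om.pair Φ.2 (V.negLtrCLM Φ.1 k) = _
  rw [negLtrCLM_apply, SmoothVB.pair_neg]
  rfl

/-- The core part of `ξ` enters as a variable `κ`, so that `contMDiff_dual_one` can insert a family
whose smoothness is shown separately. -/
lemma ev_dual_one (χ : V.core.dual.Tot) (ξ : Om.Tot) (h : ξ.1 = S.one χ.1) (κ : V.core.Tot)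
    (hκ : κ.1 = χ.1) (hi : V.inc κ = Om.tsub ξ (V.total.one (V.total.src ξ))) :
    Om.ev (V.dualData.total.one χ) ξ = V.core.ev χ κ := by
  obtain ⟨θ, rfl⟩ := Om.exists_mk h
  have h1 : Om.ev (V.dualData.total.one χ) ⟨S.one χ.1, θ⟩ =
      Om.pair (V.dualData.one χ.1 χ.2) θ := SmoothVB.ev_mk _ _ _
  have h2 : κ = ⟨χ.1, V.corePart χ.1 θ⟩ :=
    V.inc_injective hκ (hi.trans (V.inc_corePart _ _).symm)
  rw [h1, h2]
  exact (SmoothVB.ev_mk (V := V.core) χ.1 χ.2 _).symm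

lemma ev_dual_one_tadd (χ : V.core.dual.Tot) (b : B.Tot) (κ : V.core.Tot)
    (hb : b.1 = χ.1) (hκ : κ.1 = χ.1) :
    Om.ev (V.dualData.total.one χ) (Om.tadd (V.total.one b) (V.inc κ)) = V.core.ev χ κ := by
  have hoi : (V.total.one b).1 = (V.inc κ).1 := congrArg S.one (hb.trans hκ.symm)
  refine V.ev_dual_one χ _ (congrArg S.one hb) κ hκ ?_
  rw [V.src_tadd hoi, V.isLieGroupoid.src_one, V.src_inc, SmoothVB.tadd_zero (hb.trans hκ.symm)]
  obtain ⟨p, b⟩ := b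
  obtain ⟨k, rfl⟩ := V.core.exists_mk (x := p) (hκ.trans hb.symm)
  simp [inc, VBGroupoidData.total]

lemma ev_dual_inv (Φ : Om.dual.Tot) (ξ : Om.Tot) (h : ξ.1 = S.inv Φ.1) :
    Om.ev (V.dualData.total.inv Φ) ξ = -Om.ev Φ (V.total.inv ξ) := by
  obtain ⟨θ, rfl⟩ := Om.exists_mk h
  exact (SmoothVB.ev_mk _ _ _).trans (SmoothVB.pair_toDual _ _ _)

lemma base_eq {Ψ Φ : Om.dual.Tot} (h : V.dualData.total.src Ψ = V.dualData.total.tgt Φ) :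
    S.src Ψ.1 = S.tgt Φ.1 := congrArg TotalSpace.proj h

/-- The pairs of composable vectors over a pair of composable arrows. -/
def composable {δ γ : G} (h : S.src δ = S.tgt γ) : Submodule ℝ (Om.fib δ × Om.fib γ) where
  carrier := {x | V.total.src ⟨δ, x.1⟩ = V.total.tgt ⟨γ, x.2⟩}
  zero_mem' := (V.src_zero δ).trans ((congrArg B.zero h).trans (V.tgt_zero γ).symm)
  add_mem' := fun {x y} hx hy => by
    have hx : V.total.src ⟨δ, x.1⟩ = V.total.tgt ⟨γ, x.2⟩ := hx
    have hy : V.total.src ⟨δ, y.1⟩ = V.total.tgt ⟨γ, y.2⟩ := hy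
    change V.total.src ⟨δ, x.1 + y.1⟩ = V.total.tgt ⟨γ, x.2 + y.2⟩
    rw [← SmoothVB.tadd_mk, ← SmoothVB.tadd_mk, V.src_tadd (ξ := ⟨δ, x.1⟩) (η := ⟨δ, y.1⟩) rfl,
      V.tgt_tadd (ξ := ⟨γ, x.2⟩) (η := ⟨γ, y.2⟩) rfl, hx, hy]
  smul_mem' := fun c x hx => by
    have hx : V.total.src ⟨δ, x.1⟩ = V.total.tgt ⟨γ, x.2⟩ := hx
    change V.total.src ⟨δ, c • x.1⟩ = V.total.tgt ⟨γ, c • x.2⟩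
    rw [← SmoothVB.tsmul_mk, ← SmoothVB.tsmul_mk, V.src_tsmul, V.tgt_tsmul, hx]

/-- The product as a linear map on composable pairs. -/
def mulLin {δ γ : G} (h : S.src δ = S.tgt γ) : V.composable h →ₗ[ℝ] Om.fib (S.mul δ γ) where
  toFun x := V.mul δ γ x.1.1 x.1.2
  map_add' x y := V.mul_add δ γ _ _ _ _ x.2 y.2
  map_smul' c x := V.mul_smul δ γ c _ _ x.2

lemma mulLin_surjective {δ γ : G} (h : S.src δ = S.tgt γ) : Function.Surjective (V.mulLin h) := by
  intro θ
  obtain ⟨η, ξ, h1, h2, hc, hm⟩ := V.exists_mul_eq h (θ := ⟨_, θ⟩) rfl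
  obtain ⟨η, rfl⟩ := Om.exists_mk h1
  obtain ⟨ξ, rfl⟩ := Om.exists_mk h2
  exact ⟨⟨(η, ξ), hc⟩, Om.mk_inj.1 hm⟩

/-- The sum of the two pairings must vanish on the kernel of multiplication. A pair in this kernel
is `(0_δ k⁻¹, k 0_γ)`, and equality of the source of `Ψ` and the target of `Φ`, evaluated at `k`,
reads `-⟨Ψ, 0_δ k⁻¹⟩ = ⟨Φ, k 0_γ⟩`. -/
lemma exists_isDualMul {Ψ Φ : Om.dual.Tot}
    (h : V.dualData.total.src Ψ = V.dualData.total.tgt Φ) : ∃ Θ, V.IsDualMul Ψ.2 Φ.2 Θ := by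
  obtain ⟨δ, Ψ⟩ := Ψ
  obtain ⟨γ, Φ⟩ := Φ
  have hb : S.src δ = S.tgt γ := V.base_eq h
  let u : V.composable hb →ₗ[ℝ] ℝ :=
    { toFun := fun x => Om.pair Ψ x.1.1 + Om.pair Φ x.1.2
      map_add' := fun x y => by
        change Om.pair Ψ (x.1.1 + y.1.1) + Om.pair Φ (x.1.2 + y.1.2) = _
        rw [SmoothVB.pair_add, SmoothVB.pair_add]
        ring
      map_smul' := fun c x => by
        change Om.pair Ψ (c • x.1.1) + Om.pair Φ (c • x.1.2) = c • _
        rw [SmoothVB.pair_smul, SmoothVB.pair_smul, smul_eq_mul]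
        ring }
  have hker : ∀ x, V.mulLin hb x = 0 → u x = 0 := by
    rintro ⟨⟨η, ξ⟩, hc⟩ hx
    have hx' : V.total.mul ⟨δ, η⟩ ⟨γ, ξ⟩ = Om.zero (S.mul δ γ) := Om.mk_inj.2 hx
    obtain ⟨κ, hκ, h1, h2⟩ := V.exists_of_mul_eq_zero hc hx'
    have e1 := V.core_ev_tgt ⟨γ, Φ⟩ κ hκ
    have e2 := V.core_ev_src ⟨δ, Ψ⟩ κ (hκ.trans hb.symm)
    rw [← h, e2] at e1
    change V.total.src _ = _ at hc
    change Om.pair Ψ η + Om.pair Φ ξ = 0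
    have e3 : Om.pair Ψ η = Om.ev ⟨δ, Ψ⟩ ⟨δ, η⟩ := by simp
    have e4 : Om.pair Φ ξ = Om.ev ⟨γ, Φ⟩ ⟨γ, ξ⟩ := by simp
    rw [e3, e4, h1, h2]
    change Om.ev ⟨δ, Ψ⟩ (V.ltr δ κ) + Om.ev ⟨γ, Φ⟩ (V.rtr γ κ) = 0
    change -Om.ev ⟨δ, Ψ⟩ (V.ltr δ κ) = Om.ev ⟨γ, Φ⟩ (V.rtr γ κ) at e1
    rw [← e1, add_neg_cancel]
  -- Descend along the multiplication by composing with a linear section `r`; by `hker` the value at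
  -- a product does not depend on its factorization.
  obtain ⟨r, hr⟩ := (V.mulLin hb).exists_rightInverse_of_surjective
    (LinearMap.range_eq_top.2 (V.mulLin_surjective hb))
  refine ⟨Om.toDual (u ∘ₗ r), fun η ξ hc => ?_⟩
  let x : V.composable hb := ⟨(η, ξ), hc⟩
  have h1 : u (r (V.mulLin hb x) - x) = 0 := by
    apply hker
    rw [map_sub]
    have := congrArg (fun l => l (V.mulLin hb x)) hr
    exact sub_eq_zero.2 this
  rw [map_sub, sub_eq_zero] at h1
  exact (SmoothVB.pair_toDual _ _ _).trans h1

lemma pair_dual_mul {δ γ : G} {Ψ : Om.dual.fib δ} {Φ : Om.dual.fib γ}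
    (h : V.dualData.total.src ⟨δ, Ψ⟩ = V.dualData.total.tgt ⟨γ, Φ⟩) :
    V.IsDualMul Ψ Φ (V.dualData.mul δ γ Ψ Φ) := by
  have h1 := V.exists_isDualMul h
  have h2 : V.dualData.mul δ γ Ψ Φ = h1.choose := dif_pos h1
  rw [h2]
  exact h1.choose_spec

lemma ev_dual_mul {Ψ Φ : Om.dual.Tot} {η ξ : Om.Tot}
    (h : V.dualData.total.src Ψ = V.dualData.total.tgt Φ) (hc : V.total.src η = V.total.tgt ξ)
    (hη : η.1 = Ψ.1) (hξ : ξ.1 = Φ.1) :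
    Om.ev (V.dualData.total.mul Ψ Φ) (V.total.mul η ξ) = Om.ev Ψ η + Om.ev Φ ξ := by
  obtain ⟨δ, Ψ⟩ := Ψ
  obtain ⟨γ, Φ⟩ := Φ
  obtain ⟨η, rfl⟩ := Om.exists_mk (x := δ) hη
  obtain ⟨ξ, rfl⟩ := Om.exists_mk (x := γ) hξ
  have h1 : Om.ev (V.dualData.total.mul ⟨δ, Ψ⟩ ⟨γ, Φ⟩) (V.total.mul ⟨δ, η⟩ ⟨γ, ξ⟩) =
    Om.pair (V.dualData.mul δ γ Ψ Φ) (V.mul δ γ η ξ) := SmoothVB.ev_mk _ _ _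
  rw [h1, V.pair_dual_mul h η ξ hc, SmoothVB.ev_mk, SmoothVB.ev_mk]

end ev

end VBGroupoid

namespace VBGroupoid

variable {EG HG EP HP : Type*}
  [NormedAddCommGroup EG] [NormedSpace ℝ EG] [TopologicalSpace HG]
  [NormedAddCommGroup EP] [NormedSpace ℝ EP] [TopologicalSpace HP]
  {I : ModelWithCorners ℝ EG HG} {J : ModelWithCorners ℝ EP HP}
  {G P : Type*} [TopologicalSpace G] [ChartedSpace HG G] [TopologicalSpace P] [ChartedSpace HP P]
  {S : LieGroupoid I J G P} {Om : SmoothVB I G} {B : SmoothVB J P} (V : VBGroupoid S Om B)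

/-! ### Translations of core elements -/

section translations

lemma inc_zero (p : P) : V.inc (V.core.zero p) = Om.zero (S.one p) :=
  Om.mk_inj.2 (map_zero (V.coreIncl p))

lemma rtr_one {p : P} {κ : V.core.Tot} (h : κ.1 = p) : V.rtr (S.one p) κ = V.inc κ := by
  have h1 := V.isLieGroupoid.mul_one (V.inc κ)
  rw [V.src_inc, V.one_zero, h] at h1
  exact h1

lemma ltr_one {p : P} {κ : V.core.Tot} (h : κ.1 = p) :
    V.ltr (S.one p) κ = V.total.inv (V.inc κ) := by
  have h1 := V.isLieGroupoid.one_mul (V.total.inv (V.inc κ))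
  rw [V.isLieGroupoid.tgt_inv, V.src_inc, V.one_zero, h] at h1
  exact h1

/-- Additivity of the product applied to `(k + 0)(0 + k⁻¹)`: the left side is `k k⁻¹`, an identity,
and the right side is `k 0 + 0 k⁻¹ = k + k⁻¹`. -/
lemma inc_tadd_inv (κ : V.core.Tot) :
    Om.tadd (V.inc κ) (V.total.inv (V.inc κ)) = V.total.one (V.total.tgt (V.inc κ)) := by
  have hS := S.isLieGroupoid
  have h1 : (V.total.inv (V.inc κ)).1 = S.one κ.1 := hS.inv_one κ.1
  have h := V.mul_tadd (ξ := V.inc κ) (ξ' := Om.zero (S.one κ.1)) (η := Om.zero (S.one κ.1))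
    (η' := V.total.inv (V.inc κ)) rfl h1.symm (V.src_inc_eq κ (hS.tgt_one κ.1).symm)
    (V.tgt_inv_inc_eq κ (hS.src_one κ.1).symm)
  rw [SmoothVB.tadd_zero (ξ := V.inc κ) (x := S.one κ.1) rfl, SmoothVB.zero_tadd h1, V.isLieGroupoid.mul_inv] at h
  rw [h]
  exact congrArg₂ Om.tadd (V.rtr_one rfl).symm (V.ltr_one rfl).symm

lemma ltr_mul {δ γ : G} (h : S.src δ = S.tgt γ) {κ : V.core.Tot} (hκ : κ.1 = S.src γ) :
    V.ltr (S.mul δ γ) κ = V.total.mul (Om.zero δ) (V.ltr γ κ) := by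
  rw [ltr, ← V.mul_zero h, V.isLieGroupoid.mul_assoc _ _ _ _ (V.tgt_inv_inc_eq κ hκ), ltr]
  rw [V.src_zero, V.tgt_zero, h]

lemma rtr_mul {δ γ : G} (h : S.src δ = S.tgt γ) {κ : V.core.Tot} (hκ : κ.1 = S.tgt δ) :
    V.rtr (S.mul δ γ) κ = V.total.mul (V.rtr δ κ) (Om.zero γ) := by
  rw [rtr, ← V.mul_zero h, ← V.isLieGroupoid.mul_assoc _ _ _ (V.src_inc_eq κ hκ), rtr]
  rw [V.src_zero, V.tgt_zero, h]

lemma tgt_ltr {γ : G} {κ : V.core.Tot} (hκ : κ.1 = S.src γ) :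
    V.total.tgt (V.ltr γ κ) = B.zero (S.tgt γ) := by
  rw [ltr, V.isLieGroupoid.tgt_mul _ _ (V.tgt_inv_inc_eq κ hκ), V.tgt_zero]

lemma src_rtr {γ : G} {κ : V.core.Tot} (hκ : κ.1 = S.tgt γ) :
    V.total.src (V.rtr γ κ) = B.zero (S.src γ) := by
  rw [rtr, V.isLieGroupoid.src_mul _ _ (V.src_inc_eq κ hκ), V.src_zero]

lemma inv_ltr {γ : G} {κ : V.core.Tot} (hκ : κ.1 = S.src γ) :
    V.total.inv (V.ltr γ κ) = V.rtr (S.inv γ) κ := by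
  rw [ltr, V.isLieGroupoid.mul_inv_rev (V.tgt_inv_inc_eq κ hκ), V.isLieGroupoid.inv_inv,
    V.inv_zero, rtr]

lemma inv_rtr {γ : G} {κ : V.core.Tot} (hκ : κ.1 = S.tgt γ) :
    V.total.inv (V.rtr γ κ) = V.ltr (S.inv γ) κ := by
  rw [rtr, V.isLieGroupoid.mul_inv_rev (V.src_inc_eq κ hκ), V.inv_zero, ltr]

/-- Right translation is undone by multiplying with the inverse of `0_γ`. The left-handed version
follows because inversion exchanges the two translations. -/
lemma rtr_eq_zero {γ : G} {κ : V.core.Tot} (hκ : κ.1 = S.tgt γ) (h : V.rtr γ κ = Om.zero γ) :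
    κ = V.core.zero κ.1 := by
  have h1 := V.isLieGroupoid.mul_mul_inv (V.src_inc_eq κ hκ)
  rw [← rtr, h, V.isLieGroupoid.mul_inv, V.tgt_zero, V.one_zero] at h1
  refine V.inc_injective rfl ?_
  rw [← h1, ← hκ, V.inc_zero]

lemma ltr_eq_zero {γ : G} {κ : V.core.Tot} (hκ : κ.1 = S.src γ) (h : V.ltr γ κ = Om.zero γ) :
    κ = V.core.zero κ.1 := by
  have h1 := V.inv_ltr hκ
  rw [h, V.inv_zero] at h1
  exact V.rtr_eq_zero (hκ.trans (S.isLieGroupoid.tgt_inv γ).symm) h1.symm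

lemma rtrCLM_injective (γ : G) : Function.Injective (V.rtrCLM γ) := by
  rw [injective_iff_map_eq_zero]
  intro k hk
  rw [rtrCLM_apply] at hk
  have h1 : V.rtr γ ⟨S.tgt γ, k⟩ = Om.zero γ := by
    rw [← Om.mk_fibAt (V.rtr_fst (κ := ⟨S.tgt γ, k⟩) rfl), hk, SmoothVB.zero]
  exact V.core.mk_inj.1 (V.rtr_eq_zero rfl h1)

lemma negLtrCLM_injective (γ : G) : Function.Injective (V.negLtrCLM γ) := by
  rw [injective_iff_map_eq_zero]
  intro k hk
  rw [negLtrCLM_apply, neg_eq_zero] at hk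
  have h1 : V.ltr γ ⟨S.src γ, k⟩ = Om.zero γ := by
    rw [← Om.mk_fibAt (V.ltr_fst (κ := ⟨S.src γ, k⟩) rfl), hk, SmoothVB.zero]
  exact V.core.mk_inj.1 (V.ltr_eq_zero rfl h1)

end translations

/-! ### The groupoid laws of the dual -/

section laws

lemma ev_dual_one_one (χ : V.core.dual.Tot) (b : B.Tot) (hb : b.1 = χ.1) :
    Om.ev (V.dualData.total.one χ) (V.total.one b) = 0 := by
  have h := V.ev_dual_one_tadd χ b (V.core.zero χ.1) hb rfl
  rwa [V.inc_zero, SmoothVB.tadd_zero (congrArg S.one hb), SmoothVB.ev_zero] at h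

lemma ev_dual_one_inc (χ : V.core.dual.Tot) (κ : V.core.Tot) (hκ : κ.1 = χ.1) :
    Om.ev (V.dualData.total.one χ) (V.inc κ) = V.core.ev χ κ := by
  have h := V.ev_dual_one_tadd χ (B.zero χ.1) κ rfl hκ
  rwa [V.one_zero, SmoothVB.zero_tadd (congrArg S.one hκ)] at h

/-- The sum `k + k⁻¹` is an identity, on which `1_χ` vanishes. This sign cancels the one in the
source formula, so that `1_χ` has source `χ`. -/
lemma ev_dual_one_inv_inc (χ : V.core.dual.Tot) (κ : V.core.Tot) (hκ : κ.1 = χ.1) :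
    Om.ev (V.dualData.total.one χ) (V.total.inv (V.inc κ)) = -V.core.ev χ κ := by
  have h1 : (V.inc κ).1 = S.one χ.1 := congrArg S.one hκ
  have h2 : (V.total.inv (V.inc κ)).1 = S.one χ.1 :=
    (congrArg S.inv h1).trans (S.isLieGroupoid.inv_one _)
  have h := V.ev_dual_one_one χ (V.total.tgt (V.inc κ))
    ((congrArg S.tgt h1).trans (S.isLieGroupoid.tgt_one _))
  rw [← V.inc_tadd_inv, SmoothVB.ev_tadd h1 h2, V.ev_dual_one_inc χ κ hκ] at h
  exact eq_neg_of_add_eq_zero_right h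

lemma dual_src_one (χ : V.core.dual.Tot) : V.dualData.total.src (V.dualData.total.one χ) = χ := by
  have hb : S.src (S.one χ.1) = χ.1 := S.isLieGroupoid.src_one _
  refine SmoothVB.tot_dual_ext hb fun κ hκ => ?_
  have hκ : κ.1 = S.src (S.one χ.1) := hκ
  rw [V.core_ev_src _ κ hκ]
  change -Om.ev _ (V.ltr (S.one χ.1) κ) = _
  rw [V.ltr_one (hκ.trans hb), V.ev_dual_one_inv_inc χ κ (hκ.trans hb), neg_neg]

lemma dual_tgt_one (χ : V.core.dual.Tot) : V.dualData.total.tgt (V.dualData.total.one χ) = χ := by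
  have hb : S.tgt (S.one χ.1) = χ.1 := S.isLieGroupoid.tgt_one _
  refine SmoothVB.tot_dual_ext hb fun κ hκ => ?_
  have hκ : κ.1 = S.tgt (S.one χ.1) := hκ
  rw [V.core_ev_tgt _ κ hκ]
  change Om.ev _ (V.rtr (S.one χ.1) κ) = _
  rw [V.rtr_one (hκ.trans hb), V.ev_dual_one_inc χ κ (hκ.trans hb)]

variable {Ψ Φ Χ : Om.dual.Tot}

/-- Factor the translate as `0_{δγ} k⁻¹ = 0_δ (0_γ k⁻¹)`; the pairing of `Ψ` with `0_δ` drops out.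
-/
lemma dual_src_mul (h : V.dualData.total.src Ψ = V.dualData.total.tgt Φ) :
    V.dualData.total.src (V.dualData.total.mul Ψ Φ) = V.dualData.total.src Φ := by
  have hb := V.base_eq h
  have hb' : S.src (S.mul Ψ.1 Φ.1) = S.src Φ.1 := S.isLieGroupoid.src_mul _ _ hb
  refine SmoothVB.tot_dual_ext hb' fun κ hκ => ?_
  have hκ : κ.1 = S.src (S.mul Ψ.1 Φ.1) := hκ
  rw [V.core_ev_src _ κ hκ, V.core_ev_src _ κ (hκ.trans hb')]
  change -Om.ev _ (V.ltr (S.mul Ψ.1 Φ.1) κ) = _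
  rw [V.ltr_mul hb (hκ.trans hb'), V.ev_dual_mul h _ rfl (V.ltr_fst (hκ.trans hb')),
    SmoothVB.ev_zero, zero_add]
  rw [V.tgt_ltr (hκ.trans hb'), V.src_zero, hb]

lemma dual_tgt_mul (h : V.dualData.total.src Ψ = V.dualData.total.tgt Φ) :
    V.dualData.total.tgt (V.dualData.total.mul Ψ Φ) = V.dualData.total.tgt Ψ := by
  have hb := V.base_eq h
  have hb' : S.tgt (S.mul Ψ.1 Φ.1) = S.tgt Ψ.1 := S.isLieGroupoid.tgt_mul _ _ hb
  refine SmoothVB.tot_dual_ext hb' fun κ hκ => ?_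
  have hκ : κ.1 = S.tgt (S.mul Ψ.1 Φ.1) := hκ
  rw [V.core_ev_tgt _ κ hκ, V.core_ev_tgt _ κ (hκ.trans hb')]
  change Om.ev _ (V.rtr (S.mul Ψ.1 Φ.1) κ) = _
  rw [V.rtr_mul hb (hκ.trans hb'), V.ev_dual_mul h _ (V.rtr_fst (hκ.trans hb')) rfl,
    SmoothVB.ev_zero, add_zero]
  rw [V.src_rtr (hκ.trans hb'), V.tgt_zero, hb]

/-- On a vector factored as `(ηξ)ζ`, both sides evaluate to `⟨Ψ, η⟩ + ⟨Φ, ξ⟩ + ⟨Χ, ζ⟩`. -/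
lemma dual_mul_assoc (h : V.dualData.total.src Ψ = V.dualData.total.tgt Φ)
    (h' : V.dualData.total.src Φ = V.dualData.total.tgt Χ) :
    V.dualData.total.mul (V.dualData.total.mul Ψ Φ) Χ =
      V.dualData.total.mul Ψ (V.dualData.total.mul Φ Χ) := by
  have hT := V.isLieGroupoid
  have hb := V.base_eq h
  have hb' := V.base_eq h'
  refine SmoothVB.tot_dual_ext (S.isLieGroupoid.mul_assoc _ _ _ hb hb') fun θ hθ => ?_
  obtain ⟨σ, ζ, hσ, hζ, hc', rfl⟩ := V.exists_mul_eq (γ := Χ.1) (δ := S.mul Ψ.1 Φ.1)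
    ((S.isLieGroupoid.src_mul _ _ hb).trans hb') (θ := θ) hθ
  obtain ⟨η, ξ, hη, hξ, hc, rfl⟩ := V.exists_mul_eq hb hσ
  have hc'' : V.total.src ξ = V.total.tgt ζ := by rw [← hc', hT.src_mul _ _ hc]
  have e1 : V.dualData.total.src (V.dualData.total.mul Ψ Φ) = V.dualData.total.tgt Χ := by
    rw [V.dual_src_mul h, h']
  have e2 : V.dualData.total.src Ψ = V.dualData.total.tgt (V.dualData.total.mul Φ Χ) := by
    rw [V.dual_tgt_mul h', h]
  have e3 : V.total.src η = V.total.tgt (V.total.mul ξ ζ) := by rw [hT.tgt_mul _ _ hc'', hc]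
  rw [V.ev_dual_mul e1 hc' hσ hζ, V.ev_dual_mul h hc hη hξ, hT.mul_assoc _ _ _ hc hc'',
    V.ev_dual_mul e2 e3 hη (congrArg₂ S.mul hξ hζ), V.ev_dual_mul h' hc'' hξ hζ, add_assoc]

/-- Evaluate on `ξ = 1 ξ`, where the identity covector pairs to zero with the identity vector. -/
lemma dual_one_mul (Φ : Om.dual.Tot) :
    V.dualData.total.mul (V.dualData.total.one (V.dualData.total.tgt Φ)) Φ = Φ := by
  have hb : S.mul (S.one (S.tgt Φ.1)) Φ.1 = Φ.1 := S.isLieGroupoid.one_mul _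
  refine SmoothVB.tot_dual_ext hb fun ξ hξ => ?_
  have hξ : ξ.1 = Φ.1 := Eq.trans hξ hb
  conv_lhs => rw [← V.isLieGroupoid.one_mul ξ]
  rw [V.ev_dual_mul (V.dual_src_one _) (V.isLieGroupoid.src_one _)
    (congrArg (fun γ => S.one (S.tgt γ)) hξ) hξ, V.ev_dual_one_one _ _ (congrArg S.tgt hξ), zero_add]

lemma dual_mul_one (Φ : Om.dual.Tot) :
    V.dualData.total.mul Φ (V.dualData.total.one (V.dualData.total.src Φ)) = Φ := by
  have hb : S.mul Φ.1 (S.one (S.src Φ.1)) = Φ.1 := S.isLieGroupoid.mul_one _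
  refine SmoothVB.tot_dual_ext hb fun ξ hξ => ?_
  have hξ : ξ.1 = Φ.1 := Eq.trans hξ hb
  conv_lhs => rw [← V.isLieGroupoid.mul_one ξ]
  rw [V.ev_dual_mul (V.dual_tgt_one _).symm (V.isLieGroupoid.tgt_one _).symm hξ
    (congrArg (fun γ => S.one (S.src γ)) hξ), V.ev_dual_one_one _ _ (congrArg S.src hξ), add_zero]

/-- The inverse of `0_{γ⁻¹} k⁻¹` is `k 0_γ`, and the signs in the source and in the inverse cancel.
-/
lemma dual_src_inv (Φ : Om.dual.Tot) :
    V.dualData.total.src (V.dualData.total.inv Φ) = V.dualData.total.tgt Φ := by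
  have hb : S.src (S.inv Φ.1) = S.tgt Φ.1 := S.isLieGroupoid.src_inv _
  refine SmoothVB.tot_dual_ext hb fun κ hκ => ?_
  have hκ : κ.1 = S.src (S.inv Φ.1) := hκ
  rw [V.core_ev_src _ κ hκ, V.core_ev_tgt _ κ (hκ.trans hb)]
  change -Om.ev _ (V.ltr (S.inv Φ.1) κ) = _
  rw [V.ev_dual_inv Φ _ (V.ltr_fst hκ), V.inv_ltr hκ, S.isLieGroupoid.inv_inv, neg_neg]

lemma dual_tgt_inv (Φ : Om.dual.Tot) :
    V.dualData.total.tgt (V.dualData.total.inv Φ) = V.dualData.total.src Φ := by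
  have hb : S.tgt (S.inv Φ.1) = S.src Φ.1 := S.isLieGroupoid.tgt_inv _
  refine SmoothVB.tot_dual_ext hb fun κ hκ => ?_
  have hκ : κ.1 = S.tgt (S.inv Φ.1) := hκ
  rw [V.core_ev_tgt _ κ hκ, V.core_ev_src _ κ (hκ.trans hb)]
  change Om.ev _ (V.rtr (S.inv Φ.1) κ) = _
  rw [V.ev_dual_inv Φ _ (V.rtr_fst hκ), V.inv_rtr hκ, S.isLieGroupoid.inv_inv]

lemma dual_inv_inv (Φ : Om.dual.Tot) :
    V.dualData.total.inv (V.dualData.total.inv Φ) = Φ := by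
  have hb : S.inv (S.inv Φ.1) = Φ.1 := S.isLieGroupoid.inv_inv _
  refine SmoothVB.tot_dual_ext hb fun ξ hξ => ?_
  have hξ : ξ.1 = S.inv (S.inv Φ.1) := hξ
  have h1 : (V.total.inv ξ).1 = S.inv Φ.1 := (congrArg S.inv (hξ.trans hb))
  rw [V.ev_dual_inv _ _ hξ, V.ev_dual_inv _ _ h1, V.isLieGroupoid.inv_inv, neg_neg]

/-- Write `θ = 1_b + k` and take `ξ` over the base arrow of `Φ` with source `b`. Factoring `θ = (θ
ξ⁻¹) ξ`, the left side is `-⟨Φ, ξ θ⁻¹⟩ + ⟨Φ, ξ⟩`. Since `ξ θ⁻¹ = ξ + 0 k⁻¹`, only `-⟨Φ, 0 k⁻¹⟩`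
remains, which is the source of `Φ` evaluated at `k`. -/
lemma dual_inv_mul (Φ : Om.dual.Tot) :
    V.dualData.total.mul (V.dualData.total.inv Φ) Φ =
      V.dualData.total.one (V.dualData.total.src Φ) := by
  have hT := V.isLieGroupoid
  have hb : S.mul (S.inv Φ.1) Φ.1 = S.one (S.src Φ.1) := S.isLieGroupoid.inv_mul _
  refine SmoothVB.tot_dual_ext hb fun θ hθ => ?_
  have hθ : θ.1 = S.mul (S.inv Φ.1) Φ.1 := hθ
  have hθ' := hθ.trans hb
  obtain ⟨κ, hκ, hκθ, -⟩ := V.exists_one_tadd_inc hθ'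
  have hbs : (V.total.src θ).1 = S.src Φ.1 :=
    (congrArg S.src hθ').trans (S.isLieGroupoid.src_one _)
  obtain ⟨ξ, hξ, hs⟩ := V.exists_src_eq hbs
  have hR : Om.ev (V.dualData.total.one (V.dualData.total.src Φ)) θ = -Om.ev Φ (V.ltr Φ.1 κ) := by
    rw [← V.core_ev_src Φ κ hκ]
    conv_lhs => rw [hκθ]
    exact V.ev_dual_one_tadd _ _ _ hbs hκ
  have hc : V.total.src θ = V.total.tgt (V.total.inv ξ) := by rw [hT.tgt_inv, hs]
  have hη : (V.total.mul θ (V.total.inv ξ)).1 = S.inv Φ.1 := by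
    change S.mul θ.1 (S.inv ξ.1) = _
    rw [hθ, hξ]
    exact S.isLieGroupoid.mul_mul_inv (S.isLieGroupoid.src_inv _)
  have hηc : V.total.src (V.total.mul θ (V.total.inv ξ)) = V.total.tgt ξ := by
    rw [hT.src_mul _ _ hc, hT.src_inv]
  have hκ1 : (V.total.one (V.total.src θ)).1 = (V.inc κ).1 :=
    congrArg S.one (hbs.trans hκ.symm)
  -- Additivity of the product for `(ξ + 0)(1_b + k⁻¹)`, inversion being additive and fixing `1_b`.
  have hinv : V.total.mul ξ (V.total.inv θ) = Om.tadd ξ (V.ltr Φ.1 κ) := by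
    have h1 : V.total.inv θ =
        Om.tadd (V.total.one (V.total.src θ)) (V.total.inv (V.inc κ)) := by
      conv_lhs => rw [hκθ]
      rw [V.inv_tadd hκ1, hT.inv_one]
    have h2 : V.total.mul (Om.tadd ξ (Om.zero Φ.1))
        (Om.tadd (V.total.one (V.total.src θ)) (V.total.inv (V.inc κ))) =
        Om.tadd (V.total.mul ξ (V.total.one (V.total.src θ))) (V.ltr Φ.1 κ) :=
      V.mul_tadd hξ (((congrArg S.inv hκ1).symm.trans
        (congrArg TotalSpace.proj (hT.inv_one _))).symm) (by rw [hT.tgt_one, hs])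
        (V.tgt_inv_inc_eq κ hκ)
    rw [SmoothVB.tadd_zero hξ, ← h1, ← hs, hT.mul_one] at h2
    exact h2
  rw [hR]
  conv_lhs => rw [← hT.mul_inv_mul hs.symm]
  rw [V.ev_dual_mul (V.dual_src_inv Φ) hηc hη hξ, V.ev_dual_inv Φ _ hη, hT.mul_inv_rev hc,
    hT.inv_inv, hinv, SmoothVB.ev_tadd hξ (V.ltr_fst hκ)]
  ring

lemma dual_mul_inv (Φ : Om.dual.Tot) :
    V.dualData.total.mul Φ (V.dualData.total.inv Φ) =
      V.dualData.total.one (V.dualData.total.tgt Φ) := by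
  have h := V.dual_inv_mul (V.dualData.total.inv Φ)
  rwa [V.dual_inv_inv, V.dual_src_inv] at h

end laws

end VBGroupoid

/-! ### Extension of linear forms. -/

namespace SmoothVB

variable {E H : Type*} [NormedAddCommGroup E] [NormedSpace ℝ E] [TopologicalSpace H]
  {I : ModelWithCorners ℝ E H} {M : Type*} [TopologicalSpace M] [ChartedSpace H M]
  {E' H' : Type*} [NormedAddCommGroup E'] [NormedSpace ℝ E'] [TopologicalSpace H']
  {I' : ModelWithCorners ℝ E' H'} {M' : Type*} [TopologicalSpace M'] [ChartedSpace H' M']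

/-- Linear forms extend along injective linear maps between fibres. -/
lemma exists_dual_extension (V : SmoothVB I M) (W : SmoothVB I' M') {x : M} {y : M'}
    (A : V.fib x →L[ℝ] W.fib y) (hA : Function.Injective A) (φ : V.dual.fib x) :
    ∃ ψ : W.dual.fib y, ∀ v, W.pair ψ (A v) = V.pair φ v := by
  obtain ⟨l, hl⟩ := (A : V.fib x →ₗ[ℝ] W.fib y).exists_leftInverse_of_injective
    (LinearMap.ker_eq_bot.2 hA)
  let φ' : V.fib x →L[ℝ] ℝ := φ
  refine ⟨W.toDual ((φ' : V.fib x →ₗ[ℝ] ℝ) ∘ₗ l), fun v => ?_⟩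
  rw [pair_toDual]
  have h1 : l (A v) = v := congrArg (fun m => m v) hl
  exact congrArg φ' h1

end SmoothVB

/-! ### Smoothness of the dual structure maps, and the dual VB-groupoid. -/

namespace VBGroupoid

variable {EG HG EP HP : Type*}
  [NormedAddCommGroup EG] [NormedSpace ℝ EG] [TopologicalSpace HG]
  [NormedAddCommGroup EP] [NormedSpace ℝ EP] [TopologicalSpace HP]
  {I : ModelWithCorners ℝ EG HG} {J : ModelWithCorners ℝ EP HP}
  {G P : Type*} [TopologicalSpace G] [ChartedSpace HG G] [TopologicalSpace P] [ChartedSpace HP P]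
  {S : LieGroupoid I J G P} {Om : SmoothVB I G} {B : SmoothVB J P} (V : VBGroupoid S Om B)
  {EN HN : Type*} [NormedAddCommGroup EN] [NormedSpace ℝ EN] [TopologicalSpace HN]
  {IN : ModelWithCorners ℝ EN HN} {N : Type*} [TopologicalSpace N] [ChartedSpace HN N]

section smooth
variable {s : Set N} {x₀ : N}

lemma contMDiffWithinAt_mul {η ξ : N → Om.Tot} (hx₀ : x₀ ∈ s)
    (hη : ContMDiffWithinAt IN Om.model ∞ η s x₀) (hξ : ContMDiffWithinAt IN Om.model ∞ ξ s x₀)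
    (h : ∀ x ∈ s, V.total.src (η x) = V.total.tgt (ξ x)) :
    ContMDiffWithinAt IN Om.model ∞ (fun x => V.total.mul (η x) (ξ x)) s x₀ :=
  ContMDiffWithinAt.comp x₀ (f := fun x => (η x, ξ x))
    (g := fun y : Om.Tot × Om.Tot => V.total.mul y.1 y.2)
    (t := {y | V.total.src y.1 = V.total.tgt y.2})
    (V.isLieGroupoid.contMDiff_mul (η x₀, ξ x₀) (h x₀ hx₀)) (hη.prodMk hξ) h

lemma contMDiffWithinAt_inv {ξ : N → Om.Tot} (hξ : ContMDiffWithinAt IN Om.model ∞ ξ s x₀) :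
    ContMDiffWithinAt IN Om.model ∞ (fun x => V.total.inv (ξ x)) s x₀ :=
  V.isLieGroupoid.contMDiff_inv.contMDiffAt.comp_contMDiffWithinAt x₀ hξ

lemma contMDiffWithinAt_inc {κ : N → V.core.Tot}
    (hκ : ContMDiffWithinAt IN V.core.model ∞ κ s x₀) :
    ContMDiffWithinAt IN Om.model ∞ (fun x => V.inc (κ x)) s x₀ :=
  V.coreFamily.contMDiff_incl.contMDiffAt.comp_contMDiffWithinAt x₀ hκ

lemma contMDiffWithinAt_of_inc {κ : N → V.core.Tot}
    (hb : ContMDiffWithinAt IN J ∞ (fun x => (κ x).1) s x₀)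
    (hκ : ContMDiffWithinAt IN Om.model ∞ (fun x => V.inc (κ x)) s x₀) :
    ContMDiffWithinAt IN V.core.model ∞ κ s x₀ :=
  V.coreFamily.contMDiffWithinAt_of_incl hb hκ

lemma contMDiffWithinAt_rtr {γ : N → G} {κ : N → V.core.Tot} (hx₀ : x₀ ∈ s)
    (hγ : ContMDiffWithinAt IN I ∞ γ s x₀) (hκ : ContMDiffWithinAt IN V.core.model ∞ κ s x₀)
    (h : ∀ x ∈ s, (κ x).1 = S.tgt (γ x)) :
    ContMDiffWithinAt IN Om.model ∞ (fun x => V.rtr (γ x) (κ x)) s x₀ :=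
  V.contMDiffWithinAt_mul hx₀ (V.contMDiffWithinAt_inc hκ)
    (SmoothVB.contMDiff_zero.contMDiffAt.comp_contMDiffWithinAt x₀ hγ)
    fun x hx => V.src_inc_eq _ (h x hx)

lemma contMDiffWithinAt_ltr {γ : N → G} {κ : N → V.core.Tot} (hx₀ : x₀ ∈ s)
    (hγ : ContMDiffWithinAt IN I ∞ γ s x₀) (hκ : ContMDiffWithinAt IN V.core.model ∞ κ s x₀)
    (h : ∀ x ∈ s, (κ x).1 = S.src (γ x)) :
    ContMDiffWithinAt IN Om.model ∞ (fun x => V.ltr (γ x) (κ x)) s x₀ :=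
  V.contMDiffWithinAt_mul hx₀ (SmoothVB.contMDiff_zero.contMDiffAt.comp_contMDiffWithinAt x₀ hγ)
    (V.contMDiffWithinAt_inv (V.contMDiffWithinAt_inc hκ))
    fun x hx => V.tgt_inv_inc_eq _ (h x hx)

/-- Elements of `Om` with prescribed source and projection can be chosen smoothly. -/
lemma exists_smooth_src {γ : N → G} {b : N → B.Tot} (hx₀ : x₀ ∈ s)
    (hγ : ContMDiffWithinAt IN I ∞ γ s x₀) (hb : ContMDiffWithinAt IN B.model ∞ b s x₀)
    (h : ∀ x ∈ s, (b x).1 = S.src (γ x)) :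
    ∃ ξ : N → Om.Tot, ContMDiffWithinAt IN Om.model ∞ ξ s x₀ ∧ (∀ x, (ξ x).1 = γ x) ∧
      ∀ x ∈ s, V.total.src (ξ x) = b x := by
  obtain ⟨ξ₀, h1, h2⟩ := V.exists_src_eq (h x₀ hx₀)
  obtain ⟨ξ₀, rfl⟩ := Om.exists_mk h1
  obtain ⟨ξ, hξ, hξ1, -, hξs⟩ := (KernelBundle.SurjFamily.ofMorphism
    S.isLieGroupoid.contMDiff_src V.src V.isLieGroupoid.contMDiff_src
    V.src_surjective).exists_lift hγ hb h ξ₀ h2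
  refine ⟨ξ, hξ, hξ1, fun x hx => ?_⟩
  rw [← hξs x hx]
  exact congrArg V.total.src (Om.mk_fibAt (hξ1 x)).symm

lemma contMDiff_dual_src :
    ContMDiff Om.dual.model V.core.dual.model ∞ V.dualData.total.src := by
  intro Φ₀
  have hp : ContMDiffAt Om.dual.model I ∞ (fun Φ : Om.dual.Tot => Φ.1) Φ₀ :=
    contMDiffAt_proj Om.dual.fib
  refine SmoothVB.contMDiffWithinAt_dual (s := Set.univ)
    (S.isLieGroupoid.contMDiff_src.contMDiffAt.comp Φ₀ hp) fun v hv hvb => ?_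
  have h1 := SmoothVB.contMDiffWithinAt_ev (s := Set.univ) (x₀ := Φ₀) contMDiffAt_id
    (V.contMDiffWithinAt_ltr trivial hp hv fun x _ => hvb x)
    (fun x _ => V.ltr_fst (hvb x)) (V.ltr_fst (hvb Φ₀))
  exact h1.neg.congr (fun x _ => V.core_ev_src x (v x) (hvb x)) (V.core_ev_src _ _ (hvb Φ₀))

lemma contMDiff_dual_tgt :
    ContMDiff Om.dual.model V.core.dual.model ∞ V.dualData.total.tgt := by
  intro Φ₀
  have hp : ContMDiffAt Om.dual.model I ∞ (fun Φ : Om.dual.Tot => Φ.1) Φ₀ :=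
    contMDiffAt_proj Om.dual.fib
  refine SmoothVB.contMDiffWithinAt_dual (s := Set.univ)
    (S.isLieGroupoid.contMDiff_tgt.contMDiffAt.comp Φ₀ hp) fun v hv hvb => ?_
  have h1 := SmoothVB.contMDiffWithinAt_ev (s := Set.univ) (x₀ := Φ₀) contMDiffAt_id
    (V.contMDiffWithinAt_rtr trivial hp hv fun x _ => hvb x)
    (fun x _ => V.rtr_fst (hvb x)) (V.rtr_fst (hvb Φ₀))
  exact h1.congr (fun x _ => V.core_ev_tgt x (v x) (hvb x)) (V.core_ev_tgt _ _ (hvb Φ₀))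

lemma contMDiff_dual_one :
    ContMDiff V.core.dual.model Om.dual.model ∞ V.dualData.total.one := by
  intro χ₀
  have hp : ContMDiffAt V.core.dual.model J ∞ (fun χ : V.core.dual.Tot => χ.1) χ₀ :=
    contMDiffAt_proj V.core.dual.fib
  refine SmoothVB.contMDiffWithinAt_dual (s := Set.univ)
    (S.isLieGroupoid.contMDiff_one.contMDiffAt.comp χ₀ hp) fun v hv hvb => ?_
  have hvb : ∀ χ : V.core.dual.Tot, (v χ).1 = S.one χ.1 := hvb
  choose κ hκ _ hκi using fun χ => V.exists_one_tadd_inc (hvb χ)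
  have ho : ∀ χ : V.core.dual.Tot, (V.total.one (V.total.src (v χ))).1 = (v χ).1 := fun χ =>
    (congrArg (fun γ => S.one (S.src γ)) (hvb χ)).trans
      ((congrArg S.one (S.isLieGroupoid.src_one χ.1)).trans (hvb χ).symm)
  have hoS : ContMDiffWithinAt V.core.dual.model Om.model ∞
      (fun χ => V.total.one (V.total.src (v χ))) Set.univ χ₀ :=
    (V.isLieGroupoid.contMDiff_one.comp
      V.isLieGroupoid.contMDiff_src).contMDiffAt.comp_contMDiffWithinAt χ₀ hv
  -- The core parts were chosen pointwise, but their images in `Om` are the smooth differences `v -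
  -- 1_{src v}`, and smoothness into the core can be tested in `Om`.
  have hκS : ContMDiffWithinAt V.core.dual.model V.core.model ∞ κ Set.univ χ₀ := by
    refine V.contMDiffWithinAt_of_inc (hp.congr_of_eventuallyEq (.of_forall hκ)) ?_
    refine (SmoothVB.contMDiffWithinAt_tsub hv hoS (fun χ _ => ho χ) (ho χ₀)).congr
      (fun χ _ => hκi χ) (hκi χ₀)
  have h1 := SmoothVB.contMDiffWithinAt_ev (V := V.core) (s := Set.univ) (x₀ := χ₀) contMDiffAt_id
    hκS (fun χ _ => hκ χ) (hκ χ₀)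
  exact h1.congr (fun χ _ => V.ev_dual_one χ (v χ) (hvb χ) (κ χ) (hκ χ) (hκi χ))
    (V.ev_dual_one χ₀ (v χ₀) (hvb χ₀) (κ χ₀) (hκ χ₀) (hκi χ₀))

lemma contMDiff_dual_inv :
    ContMDiff Om.dual.model Om.dual.model ∞ V.dualData.total.inv := by
  intro Φ₀
  have hp : ContMDiffAt Om.dual.model I ∞ (fun Φ : Om.dual.Tot => Φ.1) Φ₀ :=
    contMDiffAt_proj Om.dual.fib
  refine SmoothVB.contMDiffWithinAt_dual (s := Set.univ)
    (S.isLieGroupoid.contMDiff_inv.contMDiffAt.comp Φ₀ hp) fun v hv hvb => ?_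
  have hvi : ∀ Φ : Om.dual.Tot, (V.total.inv (v Φ)).1 = Φ.1 := fun Φ =>
    (congrArg S.inv (hvb Φ)).trans (S.isLieGroupoid.inv_inv Φ.1)
  have h1 := SmoothVB.contMDiffWithinAt_ev (s := Set.univ) (x₀ := Φ₀) contMDiffAt_id
    (V.contMDiffWithinAt_inv hv) (fun Φ _ => hvi Φ) (hvi Φ₀)
  exact h1.neg.congr (fun Φ _ => V.ev_dual_inv Φ (v Φ) (hvb Φ)) (V.ev_dual_inv _ _ (hvb Φ₀))

/-- Although the product is defined by choice, its pairing with a smooth test map `v` is the sum of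
two smooth pairings once `v` is factored smoothly. -/
lemma contMDiffOn_dual_mul :
    ContMDiffOn (Om.dual.model.prod Om.dual.model) Om.dual.model ∞
      (fun x : Om.dual.Tot × Om.dual.Tot => V.dualData.total.mul x.1 x.2)
      {x | V.dualData.total.src x.1 = V.dualData.total.tgt x.2} := by
  intro x₀ hx₀
  have hT := V.isLieGroupoid
  have hS := S.isLieGroupoid
  set s : Set (Om.dual.Tot × Om.dual.Tot) :=
    {x | V.dualData.total.src x.1 = V.dualData.total.tgt x.2} with hs
  have hp1 : ContMDiffWithinAt (Om.dual.model.prod Om.dual.model) I ∞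
      (fun x : Om.dual.Tot × Om.dual.Tot => x.1.1) s x₀ :=
    ((contMDiff_proj Om.dual.fib (IB := I) (n := ∞)).comp contMDiff_fst).contMDiffAt.contMDiffWithinAt
  have hp2 : ContMDiffWithinAt (Om.dual.model.prod Om.dual.model) I ∞
      (fun x : Om.dual.Tot × Om.dual.Tot => x.2.1) s x₀ :=
    ((contMDiff_proj Om.dual.fib (IB := I) (n := ∞)).comp contMDiff_snd).contMDiffAt.contMDiffWithinAt
  have hcs : ∀ x ∈ s, S.src x.1.1 = S.tgt x.2.1 := fun x hx => V.base_eq hx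
  refine SmoothVB.contMDiffWithinAt_dual (ContMDiffWithinAt.comp x₀
    (f := fun x : Om.dual.Tot × Om.dual.Tot => (x.1.1, x.2.1))
    (g := fun y : G × G => S.mul y.1 y.2) (t := {y | S.src y.1 = S.tgt y.2})
    (hS.contMDiff_mul (x₀.1.1, x₀.2.1) (hcs x₀ hx₀)) (hp1.prodMk hp2) hcs) fun v hv hvb => ?_
  have hvb : ∀ x, (v x).1 = S.mul x.1.1 x.2.1 := hvb
  -- The smooth form of `exists_mul_eq`: `ξ` has the source of `v`, and the other factor is `v ξ⁻¹`.
  -- The identities are needed only on the composable pairs `s`.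
  obtain ⟨ξ, hξ, hξb, hξs⟩ := V.exists_smooth_src (b := fun x => V.total.src (v x)) hx₀ hp2
    (hT.contMDiff_src.contMDiffAt.comp_contMDiffWithinAt x₀ hv)
    (fun x hx => (congrArg S.src (hvb x)).trans (hS.src_mul _ _ (hcs x hx)))
  have hc : ∀ x ∈ s, V.total.src (v x) = V.total.tgt (V.total.inv (ξ x)) := fun x hx => by
    rw [hT.tgt_inv, hξs x hx]
  have hηb : ∀ x ∈ s, (V.total.mul (v x) (V.total.inv (ξ x))).1 = x.1.1 := fun x hx => by
    change S.mul (v x).1 (S.inv (ξ x).1) = _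
    rw [hvb, hξb, hS.mul_mul_inv (hcs x hx)]
  have h1 := SmoothVB.contMDiffWithinAt_ev contMDiffWithinAt_fst
    (V.contMDiffWithinAt_mul hx₀ hv (V.contMDiffWithinAt_inv hξ) hc) hηb (hηb x₀ hx₀)
  have h2 := SmoothVB.contMDiffWithinAt_ev contMDiffWithinAt_snd hξ (fun x _ => hξb x) (hξb x₀)
  have key : ∀ x ∈ s, Om.ev (V.dualData.total.mul x.1 x.2) (v x) =
      Om.ev x.1 (V.total.mul (v x) (V.total.inv (ξ x))) + Om.ev x.2 (ξ x) := fun x hx => by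
    rw [← V.ev_dual_mul hx _ (hηb x hx) (hξb x), hT.mul_inv_mul (hξs x hx).symm]
    rw [hT.src_mul _ _ (hc x hx), hT.src_inv]
  exact (h1.add h2).congr key (key x₀ hx₀)

end smooth

/-- The dual source is the adjoint of an injective map, so surjectivity is extension of linear
forms. -/
lemma dual_src_surjective (γ : G) : Function.Surjective (V.dualData.src γ) := fun χ => by
  obtain ⟨Φ, hΦ⟩ := SmoothVB.exists_dual_extension V.core Om (V.negLtrCLM γ)
    (V.negLtrCLM_injective γ) χ
  exact ⟨Φ, V.core.dual_ext hΦ⟩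

lemma dual_tgt_surjective (γ : G) : Function.Surjective (V.dualData.tgt γ) := fun χ => by
  obtain ⟨Φ, hΦ⟩ := SmoothVB.exists_dual_extension V.core Om (V.rtrCLM γ)
    (V.rtrCLM_injective γ) χ
  exact ⟨Φ, V.core.dual_ext hΦ⟩

lemma isLieGroupoid_dual :
    V.dualData.total.IsLieGroupoid Om.dual.model V.core.dual.model where
  src_one := V.dual_src_one
  tgt_one := V.dual_tgt_one
  src_mul _ _ h := V.dual_src_mul h
  tgt_mul _ _ h := V.dual_tgt_mul h
  mul_assoc _ _ _ h h' := V.dual_mul_assoc h h'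
  one_mul := V.dual_one_mul
  mul_one := V.dual_mul_one
  src_inv := V.dual_src_inv
  tgt_inv := V.dual_tgt_inv
  inv_mul := V.dual_inv_mul
  mul_inv := V.dual_mul_inv
  contMDiff_src := V.contMDiff_dual_src
  contMDiff_tgt := V.contMDiff_dual_tgt
  contMDiff_one := V.contMDiff_dual_one
  contMDiff_inv := V.contMDiff_dual_inv
  contMDiff_mul := V.contMDiffOn_dual_mul
  submersion_src Φ v := by
    -- First lift the projection of `v` to `P` through the source of the base groupoid;
    -- `exists_tangent` then lifts the compatible pair.
    obtain ⟨w, hw⟩ := S.isLieGroupoid.submersion_src Φ.1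
      (mfderiv V.core.dual.model J (TotalSpace.proj : V.core.dual.Tot → P)
        (V.dualData.total.src Φ) v)
    obtain ⟨u, hu, -⟩ := KernelBundle.SurjFamily.exists_tangent S.isLieGroupoid.contMDiff_src
      V.dualData.src V.contMDiff_dual_src V.dual_src_surjective Φ v w hw.symm
    exact ⟨u, hu⟩
  submersion_tgt Φ v := by
    obtain ⟨w, hw⟩ := S.isLieGroupoid.submersion_tgt Φ.1
      (mfderiv V.core.dual.model J (TotalSpace.proj : V.core.dual.Tot → P)
        (V.dualData.total.tgt Φ) v)
    obtain ⟨u, hu, -⟩ := KernelBundle.SurjFamily.exists_tangent S.isLieGroupoid.contMDiff_tgt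
      V.dualData.tgt V.contMDiff_dual_tgt V.dual_tgt_surjective Φ v w hw.symm
    exact ⟨u, hu⟩

/-- The dual VB-groupoid. -/
def dual : VBGroupoid S Om.dual V.core.dual where
  toVBGroupoidData := V.dualData
  isLieGroupoid := V.isLieGroupoid_dual
  mul_add γ δ ξ₁ ξ₂ η₁ η₂ h₁ h₂ := by
    have hb : S.src γ = S.tgt δ := V.base_eq h₁
    have h : V.dualData.total.src ⟨γ, ξ₁ + ξ₂⟩ = V.dualData.total.tgt ⟨δ, η₁ + η₂⟩ := by
      have e1 : V.dualData.total.src ⟨γ, ξ₁ + ξ₂⟩ = V.core.dual.tadd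
          (V.dualData.total.src ⟨γ, ξ₁⟩) (V.dualData.total.src ⟨γ, ξ₂⟩) := by
        simp only [VBGroupoidData.total, map_add, SmoothVB.tadd_mk]
      have e2 : V.dualData.total.tgt ⟨δ, η₁ + η₂⟩ = V.core.dual.tadd
          (V.dualData.total.tgt ⟨δ, η₁⟩) (V.dualData.total.tgt ⟨δ, η₂⟩) := by
        simp only [VBGroupoidData.total, map_add, SmoothVB.tadd_mk]
      rw [e1, e2, h₁, h₂]
    refine Om.dual_ext fun v => ?_
    -- Products exhaust the fibre, and on a product the pairing rule is additive in the covectors.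
    obtain ⟨⟨⟨a, b⟩, hab⟩, rfl⟩ := V.mulLin_surjective hb v
    have hp := V.pair_dual_mul h a b hab
    have hp₁ := V.pair_dual_mul h₁ a b hab
    have hp₂ := V.pair_dual_mul h₂ a b hab
    change Om.pair _ (V.mul γ δ a b) = Om.pair _ (V.mul γ δ a b)
    rw [SmoothVB.add_pair, hp, hp₁, hp₂, SmoothVB.add_pair, SmoothVB.add_pair]
    ring
  mul_smul γ δ c ξ η h₁ := by
    have hb : S.src γ = S.tgt δ := V.base_eq h₁
    have h : V.dualData.total.src ⟨γ, c • ξ⟩ = V.dualData.total.tgt ⟨δ, c • η⟩ := by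
      have e1 : V.dualData.total.src ⟨γ, c • ξ⟩ = V.core.dual.tsmul c
          (V.dualData.total.src ⟨γ, ξ⟩) := by
        simp only [VBGroupoidData.total, map_smul, SmoothVB.tsmul_mk]
      have e2 : V.dualData.total.tgt ⟨δ, c • η⟩ = V.core.dual.tsmul c
          (V.dualData.total.tgt ⟨δ, η⟩) := by
        simp only [VBGroupoidData.total, map_smul, SmoothVB.tsmul_mk]
      rw [e1, e2, h₁]
    refine Om.dual_ext fun v => ?_
    obtain ⟨⟨⟨a, b⟩, hab⟩, rfl⟩ := V.mulLin_surjective hb v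
    have hp := V.pair_dual_mul h a b hab
    have hp₁ := V.pair_dual_mul h₁ a b hab
    change Om.pair _ (V.mul γ δ a b) = Om.pair _ (V.mul γ δ a b)
    rw [SmoothVB.smul_pair, hp, hp₁, SmoothVB.smul_pair, SmoothVB.smul_pair]
    ring
  src_proj_surjective b γ h := by
    obtain ⟨b', rfl⟩ := V.core.dual.exists_mk h
    obtain ⟨Φ, rfl⟩ := V.dual_src_surjective γ b'
    exact ⟨⟨γ, Φ⟩, rfl, rfl⟩
  src_proj_submersion ξ v w h := KernelBundle.SurjFamily.exists_tangent
    S.isLieGroupoid.contMDiff_src V.dualData.src V.contMDiff_dual_src V.dual_src_surjective ξ v w h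

lemma isDual_dual : V.IsDual V.dual where
  pair_tgt γ Φ k ξ h := by
    change Om.pair Φ (V.rtrCLM γ k) = _
    have h' : (⟨γ, ξ⟩ : Om.Tot) = V.rtr γ ⟨S.tgt γ, k⟩ := h
    rw [V.rtrCLM_apply, ← h', SmoothVB.fibAt_mk]
  pair_src γ Φ k ξ h := by
    change Om.pair Φ (V.negLtrCLM γ k) = _
    have h' : (⟨γ, ξ⟩ : Om.Tot) = V.ltr γ ⟨S.src γ, k⟩ := h
    rw [V.negLtrCLM_apply, ← h', SmoothVB.fibAt_mk]
  pair_mul _ _ _ _ η ξ h hc := V.pair_dual_mul h η ξ hc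
  pair_one p χ b k := by
    have h := V.ev_dual_one_tadd ⟨p, χ⟩ ⟨p, b⟩ ⟨p, k⟩ rfl rfl
    simp only [inc, VBGroupoidData.total, SmoothVB.tadd_mk, SmoothVB.ev_mk] at h
    exact h

end VBGroupoid

/-! ### Duals of morphisms and of short exact sequences of vector bundles. -/

namespace SmoothVB

variable {E H : Type*} [NormedAddCommGroup E] [NormedSpace ℝ E] [TopologicalSpace H]
  {I : ModelWithCorners ℝ E H} {M : Type*} [TopologicalSpace M] [ChartedSpace H M]
  {U V W : SmoothVB I M}

lemma pair_dual (F : V.FibHom W) {x : M} (Φ : W.dual.fib x) (v : V.fib x) :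
    V.pair (F.dual x Φ) v = W.pair Φ (F x v) := rfl

lemma FibHom.total_zero (F : V.FibHom W) (x : M) : F.total (V.zero x) = W.zero x :=
  W.mk_inj.2 (map_zero (F x))

lemma FibHom.total_tsub (F : V.FibHom W) {ξ η : V.Tot} (h : ξ.1 = η.1) :
    F.total (V.tsub ξ η) = W.tsub (F.total ξ) (F.total η) := by
  obtain ⟨x, v⟩ := ξ
  obtain ⟨w, rfl⟩ := V.exists_mk (x := x) h.symm
  rw [tsub_mk]
  simp [FibHom.total]

lemma FibHom.fibAt_total (F : V.FibHom W) {x : M} {ξ : V.Tot} (h : ξ.1 = x) :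
    W.fibAt x (F.total ξ) = F x (V.fibAt x ξ) := by
  obtain ⟨v, rfl⟩ := V.exists_mk h
  simp [FibHom.total]

lemma FibHom.ev_dual_total (F : V.FibHom W) (Φ : W.dual.Tot) {ξ : V.Tot} (h : ξ.1 = Φ.1) :
    V.ev (F.dual.total Φ) ξ = W.ev Φ (F.total ξ) := by
  simp only [ev]
  rw [F.fibAt_total h]
  rfl

/-- The test pairing of the dual map with `v` is the pairing of `Φ` with the smooth map `F v`. -/
lemma FibHom.IsMorphism.dual {F : V.FibHom W} (hF : F.IsMorphism) : F.dual.IsMorphism := by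
  intro Φ₀
  refine contMDiffWithinAt_dual (s := Set.univ) (contMDiffAt_proj W.dual.fib) fun v hv hvb => ?_
  have h1 := contMDiffWithinAt_ev (s := Set.univ) (x₀ := Φ₀) contMDiffAt_id
    (hF.contMDiffAt.comp_contMDiffWithinAt Φ₀ hv) (fun Φ _ => hvb Φ) (hvb Φ₀)
  exact h1.congr (fun Φ _ => F.ev_dual_total Φ (hvb Φ)) (F.ev_dual_total Φ₀ (hvb Φ₀))

lemma IsShortExact.dual {F : U.FibHom V} {K : V.FibHom W} (h : IsShortExact F K) :
    IsShortExact K.dual F.dual where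
  morphism_left := h.morphism_right.dual
  morphism_right := h.morphism_left.dual
  injective x Φ Ψ hΦ := by
    refine W.dual_ext fun w => ?_
    obtain ⟨v, rfl⟩ := h.surjective x w
    exact congrArg (fun Θ => V.pair Θ v) hΦ
  exact x Φ := by
    constructor
    · intro hΦ
      -- A form vanishing on the image of `F`, which is the kernel of `K`, factors through `K`:
      -- compose it with a linear section of `K`.
      obtain ⟨l, hl⟩ := (K x : V.fib x →ₗ[ℝ] W.fib x).exists_rightInverse_of_surjective
        (LinearMap.range_eq_top.2 (h.surjective x))
      let φ : V.fib x →L[ℝ] ℝ := Φ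
      refine ⟨W.toDual ((φ : V.fib x →ₗ[ℝ] ℝ) ∘ₗ l), V.dual_ext fun v => ?_⟩
      rw [pair_dual, pair_toDual]
      have h1 : K x (l (K x v)) = K x v := congrArg (fun m => m (K x v)) hl
      have h2 : K x (l (K x v) - v) = 0 := by rw [map_sub, h1, sub_self]
      obtain ⟨u, hu⟩ := (h.exact x _).1 h2
      have h3 : V.pair Φ (F x u) = 0 := congrArg (fun Θ => U.pair Θ u) hΦ
      rw [hu, pair_sub, sub_eq_zero] at h3
      exact h3
    · rintro ⟨Ψ, rfl⟩
      refine U.dual_ext fun u => ?_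
      rw [pair_dual, pair_dual, (h.exact x _).2 ⟨u, rfl⟩, pair_zero, zero_pair]
  surjective x φ := by
    obtain ⟨ψ, hψ⟩ := exists_dual_extension U V (F x) (h.injective x) φ
    exact ⟨ψ, U.dual_ext hψ⟩

end SmoothVB

/-! ### Morphisms of VB-groupoids, their duals, and the exact sequences they induce. -/

namespace VBGroupoid

variable {EG HG EP HP : Type*}
  [NormedAddCommGroup EG] [NormedSpace ℝ EG] [TopologicalSpace HG]
  [NormedAddCommGroup EP] [NormedSpace ℝ EP] [TopologicalSpace HP]
  {I : ModelWithCorners ℝ EG HG} {J : ModelWithCorners ℝ EP HP}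
  {G P : Type*} [TopologicalSpace G] [ChartedSpace HG G] [TopologicalSpace P] [ChartedSpace HP P]
  {S : LieGroupoid I J G P}

namespace IsMorphism

variable {Om Om' : SmoothVB I G} {B B' : SmoothVB J P} {V : VBGroupoid S Om B}
  {V' : VBGroupoid S Om' B'} {F : Om.FibHom Om'} {f : B.FibHom B'}

lemma total_src (h : IsMorphism V V' F f) (ξ : Om.Tot) :
    V'.total.src (F.total ξ) = f.total (V.total.src ξ) :=
  B'.mk_inj.2 (h.map_src ξ.1 ξ.2)

lemma total_tgt (h : IsMorphism V V' F f) (ξ : Om.Tot) :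
    V'.total.tgt (F.total ξ) = f.total (V.total.tgt ξ) :=
  B'.mk_inj.2 (h.map_tgt ξ.1 ξ.2)

lemma total_one (h : IsMorphism V V' F f) (b : B.Tot) :
    F.total (V.total.one b) = V'.total.one (f.total b) :=
  Om'.mk_inj.2 (h.map_one b.1 b.2)

lemma total_mul (h : IsMorphism V V' F f) {η ξ : Om.Tot}
    (hc : V.total.src η = V.total.tgt ξ) :
    F.total (V.total.mul η ξ) = V'.total.mul (F.total η) (F.total ξ) :=
  Om'.mk_inj.2 (h.map_mul η.1 ξ.1 η.2 ξ.2 hc)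

lemma composable (h : IsMorphism V V' F f) {η ξ : Om.Tot}
    (hc : V.total.src η = V.total.tgt ξ) :
    V'.total.src (F.total η) = V'.total.tgt (F.total ξ) := by
  rw [h.total_src, h.total_tgt, hc]

/-- A morphism preserves products and identities, and inverses are unique. -/
lemma total_inv (h : IsMorphism V V' F f) (ξ : Om.Tot) :
    F.total (V.total.inv ξ) = V'.total.inv (F.total ξ) := by
  have hT := V.isLieGroupoid
  have hc := (hT.tgt_inv ξ).symm
  refine V'.isLieGroupoid.eq_inv_of_mul (h.composable hc) ?_
  rw [← h.total_mul hc, hT.mul_inv, h.total_one, h.total_tgt]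

lemma inc_total (h : IsMorphism V V' F f) (κ : V.core.Tot) :
    V'.inc (h.core.total κ) = F.total (V.inc κ) := rfl

lemma total_rtr (h : IsMorphism V V' F f) {γ : G} {κ : V.core.Tot} (hκ : κ.1 = S.tgt γ) :
    F.total (V.rtr γ κ) = V'.rtr γ (h.core.total κ) := by
  rw [rtr, h.total_mul (V.src_inc_eq κ hκ), F.total_zero, rtr, h.inc_total]

lemma total_ltr (h : IsMorphism V V' F f) {γ : G} {κ : V.core.Tot} (hκ : κ.1 = S.src γ) :
    F.total (V.ltr γ κ) = V'.ltr γ (h.core.total κ) := by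
  rw [ltr, h.total_mul (V.tgt_inv_inc_eq κ hκ), F.total_zero, h.total_inv, ltr, h.inc_total]

lemma map_rtrCLM (h : IsMorphism V V' F f) (γ : G) (k : V.core.fib (S.tgt γ)) :
    F γ (V.rtrCLM γ k) = V'.rtrCLM γ (h.core (S.tgt γ) k) := by
  rw [rtrCLM_apply, rtrCLM_apply, ← F.fibAt_total (V.rtr_fst rfl), h.total_rtr rfl]
  rfl

lemma map_negLtrCLM (h : IsMorphism V V' F f) (γ : G) (k : V.core.fib (S.src γ)) :
    F γ (V.negLtrCLM γ k) = V'.negLtrCLM γ (h.core (S.src γ) k) := by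
  rw [negLtrCLM_apply, negLtrCLM_apply, map_neg, ← F.fibAt_total (V.ltr_fst rfl),
    h.total_ltr rfl]
  rfl

/-- The core part is `θ - 1_{src θ}`, built from operations that a morphism preserves. The adjoint
identity is the compatibility of the dual map with identities. -/
lemma map_corePart (h : IsMorphism V V' F f) (p : P) (θ : Om.fib (S.one p)) :
    V'.corePart p (F (S.one p) θ) = h.core p (V.corePart p θ) := by
  have hb : (⟨S.one p, θ⟩ : Om.Tot).1 = (V.total.one (V.total.src ⟨S.one p, θ⟩)).1 :=
    (congrArg S.one (S.isLieGroupoid.src_one p)).symm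
  refine V'.core.mk_inj.1 (V'.inc_injective (κ' := h.core.total ⟨p, V.corePart p θ⟩) rfl ?_)
  rw [V'.inc_corePart, h.inc_total, V.inc_corePart, F.total_tsub hb, h.total_one, ← h.total_src]
  rfl

lemma core_isMorphism (h : IsMorphism V V' F f) : h.core.IsMorphism := by
  intro κ₀
  refine V'.contMDiffWithinAt_of_inc (s := Set.univ) (contMDiffAt_proj V.core.fib) ?_
  exact h.morphism_total.contMDiffAt.comp_contMDiffWithinAt κ₀
    (V.contMDiffWithinAt_inc contMDiffAt_id)

/-- Compatibility with source, target and identity is adjoint to `map_negLtrCLM`, `map_rtrCLM` and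
`map_corePart`; compatibility with products is checked on products of vectors. -/
lemma dual (h : IsMorphism V V' F f) : IsMorphism V'.dual V.dual F.dual h.core.dual := by
  have hsrc : ∀ γ (Φ : Om'.dual.fib γ), V.dualData.src γ (F.dual γ Φ) =
      h.core.dual (S.src γ) (V'.dualData.src γ Φ) := fun γ Φ =>
    V.core.dual_ext fun k => congrArg (Om'.pair Φ) (h.map_negLtrCLM γ k)
  have htgt : ∀ γ (Φ : Om'.dual.fib γ), V.dualData.tgt γ (F.dual γ Φ) =
      h.core.dual (S.tgt γ) (V'.dualData.tgt γ Φ) := fun γ Φ =>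
    V.core.dual_ext fun k => congrArg (Om'.pair Φ) (h.map_rtrCLM γ k)
  refine ⟨h.morphism_total.dual, h.core_isMorphism.dual, hsrc, htgt, fun p χ => ?_,
    fun δ γ Ψ Φ hc => ?_⟩
  · exact Om.dual_ext fun θ => congrArg (V'.core.pair χ) (h.map_corePart p θ)
  · have hc : V'.dualData.total.src ⟨δ, Ψ⟩ = V'.dualData.total.tgt ⟨γ, Φ⟩ := hc
    have hc' : V.dualData.total.src ⟨δ, F.dual δ Ψ⟩ = V.dualData.total.tgt ⟨γ, F.dual γ Φ⟩ := by
      simp only [VBGroupoidData.total] at hc ⊢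
      rw [hsrc, htgt]
      exact congrArg h.core.dual.total hc
    refine Om.dual_ext fun v => ?_
    obtain ⟨⟨⟨a, b⟩, hab⟩, rfl⟩ := V.mulLin_surjective (V.base_eq hc') v
    have e1 := V.pair_dual_mul hc' a b hab
    have e2 := V'.pair_dual_mul hc (F δ a) (F γ b) (h.composable hab)
    have e3 := h.map_mul δ γ a b hab
    change Om'.pair (V'.dualData.mul δ γ Ψ Φ) (F _ (V.mul δ γ a b)) =
      Om.pair (V.dualData.mul δ γ (F.dual δ Ψ) (F.dual γ Φ)) (V.mul δ γ a b)
    rw [e1, e3, e2]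
    rfl

end IsMorphism

namespace IsShortExact

variable {Om₁ Om₂ Om₃ : SmoothVB I G} {B₁ B₂ B₃ : SmoothVB J P}
  {V₁ : VBGroupoid S Om₁ B₁} {V₂ : VBGroupoid S Om₂ B₂} {V₃ : VBGroupoid S Om₃ B₃}
  {F : Om₁.FibHom Om₂} {f : B₁.FibHom B₂} {H : Om₂.FibHom Om₃} {h : B₂.FibHom B₃}

/-- Each assertion is carried to the fibre over the identity arrow by `1`, settled there by
exactness of `F` and `H`, and brought back by the source, which is a left inverse of `1`. -/
lemma side (hS : IsShortExact V₁ V₂ V₃ F f H h) : SmoothVB.IsShortExact f h where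
  morphism_left := hS.morphism_left.morphism_side
  morphism_right := hS.morphism_right.morphism_side
  injective p := by
    rw [injective_iff_map_eq_zero]
    intro b hb
    have h1 := hS.morphism_left.map_one p b
    rw [hb, map_zero] at h1
    have h2 := (injective_iff_map_eq_zero (F (S.one p))).1 (hS.exact_total.injective _) _ h1
    have h3 := V₁.isLieGroupoid.src_one ⟨p, b⟩
    have h4 : V₁.total.one ⟨p, b⟩ = Om₁.zero (S.one p) := Om₁.mk_inj.2 h2
    rw [h4, V₁.src_zero, S.isLieGroupoid.src_one] at h3
    exact (B₁.mk_inj.1 h3).symm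
  exact p b := by
    constructor
    · intro hb
      have h1 := hS.morphism_right.map_one p b
      rw [hb, map_zero] at h1
      obtain ⟨ξ, hξ⟩ := (hS.exact_total.exact _ _).1 h1
      have h2 : F.total ⟨S.one p, ξ⟩ = V₂.total.one ⟨p, b⟩ := Om₂.mk_inj.2 hξ
      have h3 := hS.morphism_left.total_src ⟨S.one p, ξ⟩
      rw [h2, V₂.isLieGroupoid.src_one] at h3
      obtain ⟨b', hb'⟩ := B₁.exists_mk (x := p) (ξ := V₁.total.src ⟨S.one p, ξ⟩)
        (S.isLieGroupoid.src_one p)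
      rw [hb'] at h3
      exact ⟨b', (B₂.mk_inj.1 h3).symm⟩
    · rintro ⟨b', rfl⟩
      have h1 := hS.morphism_right.total_one (f.total ⟨p, b'⟩)
      rw [← hS.morphism_left.total_one] at h1
      have h2 : H.total (F.total (V₁.total.one ⟨p, b'⟩)) = Om₃.zero (S.one p) :=
        Om₃.mk_inj.2 ((hS.exact_total.exact _ _).2 ⟨_, rfl⟩)
      have h3 := V₃.isLieGroupoid.src_one (h.total (f.total ⟨p, b'⟩))
      rw [← h1, h2, V₃.src_zero, S.isLieGroupoid.src_one] at h3
      exact (B₃.mk_inj.1 h3).symm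
  surjective p b := by
    obtain ⟨ξ, hξ⟩ := hS.exact_total.surjective (S.one p) (V₃.one p b)
    have h2 : H.total ⟨S.one p, ξ⟩ = V₃.total.one ⟨p, b⟩ := Om₃.mk_inj.2 hξ
    have h3 := hS.morphism_right.total_src ⟨S.one p, ξ⟩
    rw [h2, V₃.isLieGroupoid.src_one] at h3
    obtain ⟨b', hb'⟩ := B₂.exists_mk (x := p) (ξ := V₂.total.src ⟨S.one p, ξ⟩)
      (S.isLieGroupoid.src_one p)
    rw [hb'] at h3
    exact ⟨b', (B₃.mk_inj.1 h3).symm⟩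

lemma core (hS : IsShortExact V₁ V₂ V₃ F f H h) :
    SmoothVB.IsShortExact hS.morphism_left.core hS.morphism_right.core where
  morphism_left := hS.morphism_left.core_isMorphism
  morphism_right := hS.morphism_right.core_isMorphism
  injective p k k' hk := Subtype.ext (hS.exact_total.injective (S.one p) (congrArg Subtype.val hk))
  exact p k := by
    constructor
    · intro hk
      have h1 : H (S.one p) (V₂.coreIncl p k) = 0 := congrArg Subtype.val hk
      obtain ⟨ξ, hξ⟩ := (hS.exact_total.exact _ _).1 h1
      have h2 := hS.morphism_left.map_src (S.one p) ξ
      rw [hξ, V₂.src_coreIncl] at h2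
      -- The preimage `ξ` already lies in the core, because `f` is injective and kills its source.
      have h3 := (injective_iff_map_eq_zero (f _)).1 (hS.side.injective _) _ h2.symm
      exact ⟨(⟨ξ, h3⟩ : V₁.coreFamily.fib p), Subtype.ext hξ⟩
    · rintro ⟨k', rfl⟩
      exact Subtype.ext ((hS.exact_total.exact (S.one p) _).2 ⟨V₁.coreIncl p k', rfl⟩)
  surjective p k := by
    obtain ⟨ξ, hξ⟩ := hS.exact_total.surjective (S.one p) (V₃.coreIncl p k)
    have h1 := hS.morphism_right.map_src (S.one p) ξ
    rw [hξ, V₃.src_coreIncl] at h1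
    -- A lift `ξ` of `k` need not have source zero, but its source comes from some `b` in `B₁`.
    -- Subtracting `F ζ`, where `ζ` has source `b`, makes the source zero without changing the image
    -- under `H`.
    obtain ⟨b, hb⟩ := (hS.side.exact _ _).1 h1.symm
    obtain ⟨ζ, rfl⟩ := V₁.src_surjective (S.one p) b
    have h2 : V₂.src (S.one p) (ξ - F (S.one p) ζ) = 0 := by
      rw [map_sub, hS.morphism_left.map_src, hb, sub_self]
    refine ⟨(⟨ξ - F (S.one p) ζ, h2⟩ : V₂.coreFamily.fib p), Subtype.ext ?_⟩
    change H (S.one p) (ξ - F (S.one p) ζ) = V₃.coreIncl p k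
    rw [map_sub, hξ, (hS.exact_total.exact _ _).2 ⟨ζ, rfl⟩, sub_zero]

lemma dual (hS : IsShortExact V₁ V₂ V₃ F f H h) :
    IsShortExact V₃.dual V₂.dual V₁.dual H.dual hS.morphism_right.core.dual
      F.dual hS.morphism_left.core.dual where
  morphism_left := hS.morphism_right.dual
  morphism_right := hS.morphism_left.dual
  exact_total := hS.exact_total.dual

end IsShortExact

end VBGroupoid

end

theorem theorem2p6
    {EG HG EP HP : Type*}
    [NormedAddCommGroup EG] [NormedSpace ℝ EG] [FiniteDimensional ℝ EG] [TopologicalSpace HG]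
    [NormedAddCommGroup EP] [NormedSpace ℝ EP] [FiniteDimensional ℝ EP] [TopologicalSpace HP]
    {I : ModelWithCorners ℝ EG HG} [I.Boundaryless] {J : ModelWithCorners ℝ EP HP} [J.Boundaryless]
    {G P : Type*} [TopologicalSpace G] [ChartedSpace HG G] [IsManifold I ∞ G]
    [TopologicalSpace P] [ChartedSpace HP P] [IsManifold J ∞ P]
    (S : LieGroupoid I J G P)
    {Om₁ Om₂ Om₃ : SmoothVB I G} {B₁ B₂ B₃ : SmoothVB J P}
    (V₁ : VBGroupoid S Om₁ B₁) (V₂ : VBGroupoid S Om₂ B₂) (V₃ : VBGroupoid S Om₃ B₃)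
    (F : Om₁.FibHom Om₂) (f : B₁.FibHom B₂) (H : Om₂.FibHom Om₃) (h : B₂.FibHom B₃)
    (hS : VBGroupoid.IsShortExact V₁ V₂ V₃ F f H h) :
    SmoothVB.IsShortExact f h ∧
    SmoothVB.IsShortExact hS.morphism_left.core hS.morphism_right.core ∧
    ∃ (W₁ : VBGroupoid S Om₁.dual V₁.core.dual) (W₂ : VBGroupoid S Om₂.dual V₂.core.dual)
      (W₃ : VBGroupoid S Om₃.dual V₃.core.dual),
      V₁.IsDual W₁ ∧ V₂.IsDual W₂ ∧ V₃.IsDual W₃ ∧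
      VBGroupoid.IsShortExact W₃ W₂ W₁ H.dual hS.morphism_right.core.dual
        F.dual hS.morphism_left.core.dual :=
  ⟨hS.side, hS.core, V₁.dual, V₂.dual, V₃.dual, V₁.isDual_dual, V₂.isDual_dual, V₃.isDual_dual,
    hS.dual⟩
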